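/- **Conventions.** A point process on $\mathbb{R}^d$ is a measurable map $\Phi$ from a probability space into the space $\mathbf{M}$ of Radon counting measures on $\mathbb{R}^d$ (Borel measures taking finite nonnegative integer values on bounded Borel sets), equipped with the $\sigma$-algebra $\mathcal{M}$ generated by the maps $\phi\mapsto\phi(B)$. It is simple if almost surely its points are distinct; $\Phi$ is then identified with its set of points. For $\phi\in\mathbf{M}$ and $x\in\mathbb{R}^d$ let $\phi_{(x)}(B)=\phi(B-x)$, and for $\Theta\in\mathcal{M}$ let $\Theta_x=\{\phi_{(x)}:\phi\in\Theta\}$. The process $\Phi$ is stationary if $\Phi_{(x)}$ has the same law as $\Phi$ for every $x\in\mathbb{R}^d$; ergodic if $\mathbb{P}(\Phi\in\Theta)\in\{0,1\}$ for every $\Theta\in\mathcal{M}$ such that $\mathbb{P}(\Phi\in\Theta\,\triangle\,\Theta_x)=0$ for all $x\in\mathbb{R}^d$; of unit intensity if $\mathbb{E}\,\Phi(B)=|B|$ (Lebesgue measure) for every bounded Borel set $B$; and it has all moments if $\mathbb{E}[\Phi(B)^m]<\infty$ for every bounded Borel set $B$ and every integer $m\ge 1$. For a finite set $\mathcal{X}\subset\mathbb{R}^d$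 and $r>0$, the Čech complex $\check{C}(\mathcal{X},r)$ is the abstract simplicial complex whose simplices are the nonempty $\sigma\subseteq\mathcal{X}$ with $\bigcap_{x\in\sigma}B_x(r)\ne\emptyset$, where $B_x(r)$ is the closed Euclidean ball of radius $r$ centred at $x$. Fix a field $\mathbb{F}$, and let $\beta_k$ be the dimension of the $k$-th (unreduced) simplicial homology with coefficients in $\mathbb{F}$. Let $W_l=[-l/2,l/2)^d$. **Theorem.** Let $\Phi$ be a simple, stationary, ergodic point process on $\mathbb{R}^d$ of unit intensity possessing all moments, let $r>0$ and let $0\le k\le d-1$. Then $\beta_k(\check{C}(\Phi\cap W_l,r))$ is integrable for every $l$, and there is a constant $\bar e_k\in[0,\infty)$ such that, as $l\to\infty$ through the real numbers, $$\frac{\mathbb{E}\,\beta_k(\check{C}(\Phi\cap W_l,r))}{l^d}\longrightarrow \bar e_k\qquad\text{and}\qquad \frac{\beta_k(\check{C}(\Phi\cap W_l,r))}{l^d}\longrightarrow \bar e_k\quad\text{almost surely.}$$ In particular, $\bar e_k$ is determined by $k$, $r$, the field $\mathbb{F}$ and the law of $\Phi$. -/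

import Mathlib

open MeasureTheory Filter Topology

noncomputable section

namespace CechBetti

/-! ### Simplicial homology of an abstract simplicial complex over a field -/

section Homology

variable (F : Type*) [Field F] {V : Type*}

/-- The oriented simplicial chains of the complex `K` spanned by the simplices with `n` vertices
(dimension `n - 1`): finitely supported functions `c` on ordered `n`-tuples of vertices that vanish
unless the entries are distinct and span a simplex of `K`, and that are alternating, i.e. take
opposite values on opposite orientations of the same simplex. An oriented simplex
`[v₁, …, vₙ]` is the function with value `sign π` at `v ∘ π` and `0` elsewhere. -/
def chains (K : PreAbstractSimplicialComplex V) (n : ℕ) : Submodule F ((Fin n → V) →₀ F) where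
  carrier := {c | (∀ v, c v ≠ 0 → Function.Injective v ∧ ∃ σ ∈ K, (σ : Set V) = Set.range v) ∧
    ∀ (v : Fin n → V) (π : Equiv.Perm (Fin n)), c (v ∘ π) = ((Equiv.Perm.sign π : ℤ) : F) * c v}
  zero_mem' := by simp
  add_mem' := by
    rintro a b ⟨ha, ha'⟩ ⟨hb, hb'⟩
    refine ⟨fun v hv => ?_, fun v π => by simp [ha', hb', mul_add]⟩
    by_cases h : a v = 0
    · exact hb v fun h0 => hv (by simp [h, h0])
    · exact ha v h
  smul_mem' := by
    rintro x a ⟨ha, ha'⟩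
    refine ⟨fun v hv => ha v fun h0 => hv (by simp [h0]), fun v π => ?_⟩
    simp only [Finsupp.smul_apply, smul_eq_mul, ha']
    ring

/-- The boundary operator, `(∂ c)(u₁, …, uₙ) = ∑ w, c (w, u₁, …, uₙ)`. On an oriented simplex it is
the usual `∂ [v₀, …, vₙ] = ∑ i, (-1) ^ i [v₀, …, v̂ᵢ, …, vₙ]`: the only `w` that contributes at
`u = (v₀, …, v̂ᵢ, …, vₙ)` is `w = vᵢ`, and moving `vᵢ` to the front has sign `(-1) ^ i`. -/
def boundary (V : Type*) (n : ℕ) : ((Fin (n + 1) → V) →₀ F) →ₗ[F] ((Fin n → V) →₀ F) :=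
  Finsupp.lmapDomain F F Fin.tail

/-- The `k`-cycles; homology is unreduced, so every `0`-chain is a cycle. -/
def cycles (K : PreAbstractSimplicialComplex V) :
    (k : ℕ) → Submodule F ((Fin (k + 1) → V) →₀ F)
  | 0 => chains F K 1
  | k + 1 => chains F K (k + 2) ⊓ LinearMap.ker (boundary F V (k + 1))

/-- The `k`-boundaries. -/
def boundaries (K : PreAbstractSimplicialComplex V) (k : ℕ) :
    Submodule F ((Fin (k + 1) → V) →₀ F) :=
  (chains F K (k + 2)).map (boundary F V (k + 1))

/-- The quotient `Z / B` of the vector space `Z` by its subspace `B`. -/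
abbrev QuotientSpace {M : Type*} [AddCommGroup M] [Module F M] (Z B : Submodule F M) : Type _ :=
  Z ⧸ B.submoduleOf Z

/-- The `k`-th simplicial homology `H_k(K; F)`, cycles modulo boundaries. -/
abbrev Homology (K : PreAbstractSimplicialComplex V) (k : ℕ) : Type _ :=
  QuotientSpace F (cycles F K k) (boundaries F K k)

/-- The `k`-th Betti number, the dimension of `H_k(K; F)`. -/
def betti (K : PreAbstractSimplicialComplex V) (k : ℕ) : ℕ :=
  Module.finrank F (Homology F K k)

end Homology

/-! ### The Čech complex -/

/-- The Čech complex of radius `r` on the point set `X`: its simplices are the nonempty finite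
subsets `σ` of `X` such that the closed balls of radius `r` around the points of `σ` have a common
point. -/
def cech {E : Type*} [PseudoMetricSpace E] (X : Set E) (r : ℝ) : PreAbstractSimplicialComplex E where
  faces := {σ | σ.Nonempty ∧ (σ : Set E) ⊆ X ∧ (⋂ x ∈ σ, Metric.closedBall x r).Nonempty}
  isRelLowerSet_faces := by
    rintro σ ⟨hσ, hX, y, hy⟩
    refine ⟨hσ, fun τ hτ hne => ⟨hne, ?_, y, ?_⟩⟩
    · exact (Finset.coe_subset.2 hτ).trans hX
    · simp only [Set.mem_iInter] at hy ⊢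
      exact fun x hx => hy x (hτ hx)

/-! ### Point processes on `ℝ^d` -/

/-- Radon counting measures on `ℝ^d`: the Borel measures taking finite nonnegative integer values
on bounded Borel sets. The space carries the `σ`-algebra generated by the evaluations `φ ↦ φ B`
(it makes no difference whether `B` runs over all Borel sets or over the bounded ones). -/
abbrev CountingMeasure (d : ℕ) : Type :=
  {φ : Measure (EuclideanSpace ℝ (Fin d)) //
    ∀ B, MeasurableSet B → Bornology.IsBounded B → ∃ n : ℕ, φ B = n}

variable {d : ℕ}

/-- The translate `φ_(x)`, with `φ_(x)(B) = φ (B - x)`. -/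
def translate (x : EuclideanSpace ℝ (Fin d)) (φ : CountingMeasure d) : CountingMeasure d :=
  ⟨φ.1.map (fun y => y + x), fun B hB hb => by
    rw [Measure.map_apply (measurable_add_const x) hB]
    refine φ.2 _ (measurable_add_const x hB) ?_
    have h : (fun y : EuclideanSpace ℝ (Fin d) => y + x) ⁻¹' B = (fun y => y + -x) '' B := by
      ext y
      simp [Set.mem_image, ← sub_eq_add_neg, sub_eq_iff_eq_add]
    rw [h]
    exact (isometry_add_right (-x)).lipschitz.isBounded_image hb⟩

/-- The set of points (atoms) of a counting measure. -/
def points (φ : CountingMeasure d) : Set (EuclideanSpace ℝ (Fin d)) :=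
  {x | φ.1 {x} ≠ 0}

/-- The window `W_l = [-l/2, l/2)^d`. -/
def window (d : ℕ) (l : ℝ) : Set (EuclideanSpace ℝ (Fin d)) :=
  {x | ∀ i, x i ∈ Set.Ico (-(l / 2)) (l / 2)}

section PointProcess

variable {Ω : Type*} [MeasurableSpace Ω] (P : Measure Ω) (Φ : Ω → CountingMeasure d)

/-- The points of `Φ` are almost surely distinct. -/
def IsSimpleProcess : Prop := ∀ᵐ ω ∂P, ∀ x, (Φ ω).1 {x} ≤ 1

/-- The law of `Φ` is invariant under translations. -/
def IsStationaryProcess : Prop :=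
  ∀ x : EuclideanSpace ℝ (Fin d), P.map (fun ω => translate x (Φ ω)) = P.map Φ

/-- Every measurable set of counting measures which, up to events of probability zero, is invariant
under all translations has probability `0` or `1`. -/
def IsErgodicProcess : Prop :=
  ∀ Θ : Set (CountingMeasure d), MeasurableSet Θ →
    (∀ x, P {ω | Φ ω ∈ (Θ \ translate x '' Θ) ∪ (translate x '' Θ \ Θ)} = 0) →
      P {ω | Φ ω ∈ Θ} = 0 ∨ P {ω | Φ ω ∈ Θ} = 1

/-- The mean number of points of `Φ` in a bounded Borel set is the Lebesgue measure of the set. -/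
def HasUnitIntensity : Prop :=
  ∀ B : Set (EuclideanSpace ℝ (Fin d)), MeasurableSet B → Bornology.IsBounded B →
    ∫⁻ ω, (Φ ω).1 B ∂P = volume B

/-- The number of points of `Φ` in any bounded Borel set has finite moments of all orders. -/
def HasAllMoments : Prop :=
  ∀ B : Set (EuclideanSpace ℝ (Fin d)), MeasurableSet B → Bornology.IsBounded B →
    ∀ k : ℕ, 1 ≤ k → ∫⁻ ω, (Φ ω).1 B ^ k ∂P < ⊤

/-- The random variable `β_k(Č(Φ ∩ W_l, r))`, with homology over the field `F`. -/
def bettiInWindow (F : Type*) [Field F] (k : ℕ) (r l : ℝ) (ω : Ω) : ℝ :=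
  betti F (cech (points (Φ ω) ∩ window d l) r) k

end PointProcess

end CechBetti

end

open CechBetti

/-! The Betti number of a window is nearly additive when the window is cut into tiles, but it is not
monotone in the complex, so the one-sided comparisons behind a law of large numbers are missing.
Adding simplex counts restores them. Write `β = dim Z - dim B`, with `Z` the `k`-cycles and `B` the
`k`-boundaries. Enlarging the complex can only increase `dim Z`, and by rank-nullity it increases
`dim B` by at most the number of new simplices of dimension `k + 1`. Hence `β` plus the number of
simplices of dimensions `k` and `k + 1` is monotone, the simplex count alone is monotone, and `β` is
the difference of the two. Both are additive over vertex-disjoint unions, invariant under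
relabelling, and grow by at most a multiple of the number of new ordered simplices.
`IsAlmostAdditive` collects these properties, and `IsAlmostAdditive.exists_limit` treats every such
functional `G`.

Tile space by cubes of side `m`. The value of `G` on a window is at least the sum over the tiles
inside it, and at most the sum over tiles covering it plus an error counting tuples that cross
between tiles. Crossing tuples live near tile boundaries, so stationarity and the moments make the
expected error per unit volume tend to `0` as `m` grows. Integrating the two bounds gives
convergence of the means.

For almost sure convergence, ergodicity under all translations does not give ergodicity under the
lattice `m ℤ^d`, so averages over a single tiling need not approach the mean. The two bounds are
therefore averaged over finitely many shifted tilings. A mean ergodic argument in `L²`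
(`exists_convexCombination_close`) supplies shifts and weights for which the averaged tile value is
close in `L¹` to its mean. The maximal inequality `measure_maximal_le` for the lattice action turns
this smallness into a bound on the probability that the window averages fail to settle near the tile
mean. Letting `m → ∞` makes that probability zero. The bounds hold for every real `l`, so no
separate interpolation between integer windows is needed. -/

noncomputable section

namespace CechBetti

/-! ### Dimension inequalities from rank-nullity -/

section LinearAlgebra

variable {F : Type*} [Field F] {M N : Type*} [AddCommGroup M] [Module F M] [AddCommGroup N]
  [Module F N]

theorem finrank_map_add_finrank_inf_ker (C : Submodule F M) [FiniteDimensional F C]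
    (f : M →ₗ[F] N) :
    Module.finrank F (C.map f) + Module.finrank F (C ⊓ LinearMap.ker f : Submodule F M)
      = Module.finrank F C := by
  have h := LinearMap.finrank_range_add_finrank_ker (f.domRestrict C)
  rw [LinearMap.range_domRestrict, LinearMap.ker_domRestrict] at h
  rw [← h]
  congr 1
  have e := (Submodule.equivSubtypeMap C (Submodule.comap C.subtype (LinearMap.ker f))).finrank_eq
  rw [e, Submodule.map_comap_subtype]

/-- The dimension lost under `f` is that of the kernel on the subspace, and the kernel on `D` lies
in the kernel on `C`. This bounds the growth of the space of boundaries. -/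
theorem finrank_map_add_le {C D : Submodule F M} [FiniteDimensional F C] (h : D ≤ C)
    (f : M →ₗ[F] N) :
    Module.finrank F (C.map f) + Module.finrank F D ≤
      Module.finrank F (D.map f) + Module.finrank F C := by
  have : FiniteDimensional F D := Submodule.finiteDimensional_of_le h
  have h1 := finrank_map_add_finrank_inf_ker C f
  have h2 := finrank_map_add_finrank_inf_ker D f
  have h3 := Submodule.finrank_mono (inf_le_inf_right (LinearMap.ker f) h)
  omega

theorem finrank_le_of_inf_ker_le {C D : Submodule F M} [FiniteDimensional F C]
    [FiniteDimensional F D] [FiniteDimensional F N] (f : M →ₗ[F] N)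
    (h : C ⊓ LinearMap.ker f ≤ D) :
    Module.finrank F C ≤ Module.finrank F D + Module.finrank F N := by
  have h1 := finrank_map_add_finrank_inf_ker C f
  have h2 := Submodule.finrank_mono h
  have h3 := Submodule.finrank_le (C.map f)
  omega

theorem finrank_map_of_injective (C : Submodule F M) {f : M →ₗ[F] N}
    (hf : Function.Injective f) : Module.finrank F (C.map f) = Module.finrank F C :=
  (Submodule.equivMapOfInjective f hf C).finrank_eq.symm

theorem finrank_quotientSpace {Z B : Submodule F M} [FiniteDimensional F Z] (h : B ≤ Z) :
    Module.finrank F (QuotientSpace F Z B) + Module.finrank F B = Module.finrank F Z := by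
  rw [← (Submodule.submoduleOfEquivOfLe h).finrank_eq]
  exact Submodule.finrank_quotient_add_finrank _

end LinearAlgebra

/-! ### Chains, cycles and boundaries under inclusion of complexes -/

section Chains

variable (F : Type*) [Field F] {V : Type*}

/-- The ordered simplices with `n` vertices of the complex `K`. -/
def orderedSimplices (K : PreAbstractSimplicialComplex V) (n : ℕ) : Set (Fin n → V) :=
  {v | Function.Injective v ∧ ∃ σ ∈ K, (σ : Set V) = Set.range v}

variable {K L : PreAbstractSimplicialComplex V} {n : ℕ}

theorem orderedSimplices_mono (h : L ≤ K) (n : ℕ) :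
    orderedSimplices L n ⊆ orderedSimplices K n :=
  fun _ ⟨hv, σ, hσ, e⟩ => ⟨hv, σ, h hσ, e⟩

theorem orderedSimplices_comp_perm {v : Fin n → V} (π : Equiv.Perm (Fin n)) :
    v ∘ π ∈ orderedSimplices K n ↔ v ∈ orderedSimplices K n := by
  simp only [orderedSimplices, Set.mem_ofPred_eq, Equiv.injective_comp]
  rw [Set.range_comp, π.surjective.range_eq, Set.image_univ]

theorem finite_orderedSimplices (hK : K.faces.Finite) (n : ℕ) :
    (orderedSimplices K n).Finite := by
  refine (hK.biUnion fun σ _ => Set.Finite.pi' (ι := Fin n) fun _ => σ.finite_toSet).subset ?_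
  rintro v ⟨-, σ, hσ, e⟩
  simp only [Set.mem_iUnion]
  refine ⟨σ, hσ, fun i => ?_⟩
  have : v i ∈ (σ : Set V) := e ▸ Set.mem_range_self i
  exact this

theorem mem_chains {c : (Fin n → V) →₀ F} :
    c ∈ chains F K n ↔ (∀ v, c v ≠ 0 → v ∈ orderedSimplices K n) ∧
      ∀ (v : Fin n → V) (π : Equiv.Perm (Fin n)),
        c (v ∘ π) = ((Equiv.Perm.sign π : ℤ) : F) * c v :=
  Iff.rfl

theorem chains_mono (h : L ≤ K) (n : ℕ) : chains F L n ≤ chains F K n :=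
  fun _ hc => ⟨fun v hv => orderedSimplices_mono h n (hc.1 v hv), hc.2⟩

theorem chains_le_supported (K : PreAbstractSimplicialComplex V) (n : ℕ) :
    chains F K n ≤ Finsupp.supported F F (orderedSimplices K n) := by
  intro c hc
  rw [Finsupp.mem_supported]
  intro v hv
  exact hc.1 v (by simpa using hv)

theorem finiteDimensional_supported {ι : Type*} {s : Set ι} (hs : s.Finite) :
    FiniteDimensional F (Finsupp.supported F F s) := by
  have := hs.to_subtype
  exact Module.Finite.equiv (Finsupp.supportedEquivFinsupp (M := F) (R := F) s).symm

theorem finiteDimensional_chains (hK : K.faces.Finite) (n : ℕ) :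
    FiniteDimensional F (chains F K n) := by
  have := finiteDimensional_supported F (finite_orderedSimplices hK n)
  exact Submodule.finiteDimensional_of_le (chains_le_supported F K n)

/-- Restrict chains of `K` to the new ordered simplices: the kernel consists of chains of `L`.
Counting orderings instead of simplices loses a factor `n!`, which is harmless. -/
theorem finrank_chains_le (hK : K.faces.Finite) (h : L ≤ K) (n : ℕ) :
    Module.finrank F (chains F K n) ≤ Module.finrank F (chains F L n) +
      (orderedSimplices K n \ orderedSimplices L n).ncard := by
  set s := orderedSimplices K n \ orderedSimplices L n
  have hs : s.Finite := (finite_orderedSimplices hK n).subset Set.sdiff_subset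
  have := finiteDimensional_chains F hK n
  have := finiteDimensional_chains F (hK.subset h) n
  have := hs.fintype
  have hr : Module.finrank F (s →₀ F) = s.ncard := by
    rw [Module.finrank_finsupp_self, ← Nat.card_eq_fintype_card, Nat.card_coe_set_eq]
  rw [← hr]
  refine finrank_le_of_inf_ker_le (Finsupp.lsubtypeDomain s) ?_
  rintro c ⟨hc, hf⟩
  refine ⟨fun v hv => ?_, hc.2⟩
  by_contra hL
  have hvs : v ∈ s := ⟨hc.1 v hv, hL⟩
  exact hv (DFunLike.congr_fun (LinearMap.mem_ker.1 hf) (⟨v, hvs⟩ : s))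

theorem boundary_apply (c : (Fin (n + 1) → V) →₀ F) :
    boundary F V n c = Finsupp.mapDomain Fin.tail c := rfl

/-- As an identity between push-forwards, alternation is carried along boundary and relabelling maps
by functoriality of `mapDomain`. -/
theorem alternating_iff_mapDomain (c : (Fin n → V) →₀ F) :
    (∀ (v : Fin n → V) (π : Equiv.Perm (Fin n)),
        c (v ∘ π) = ((Equiv.Perm.sign π : ℤ) : F) * c v) ↔
      ∀ π : Equiv.Perm (Fin n), Finsupp.mapDomain (fun v : Fin n → V => v ∘ π.symm) c =
        ((Equiv.Perm.sign π : ℤ) : F) • c := by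
  have key : ∀ (π : Equiv.Perm (Fin n)) (v : Fin n → V),
      Finsupp.mapDomain (fun v : Fin n → V => v ∘ π.symm) c v = c (v ∘ π) := by
    intro π v
    have hi : Function.Injective (fun v : Fin n → V => v ∘ π.symm) :=
      fun a b hab => π.symm.surjective.injective_comp_right hab
    rw [← Finsupp.mapDomain_apply hi c (v ∘ π)]
    congr 1
    ext i
    simp
  constructor
  · intro h π
    ext v
    rw [key, h, Finsupp.smul_apply, smul_eq_mul]
  · intro h v π
    rw [← key, h, Finsupp.smul_apply, smul_eq_mul]

theorem boundary_mem_chains {c : (Fin (n + 2) → V) →₀ F} (hc : c ∈ chains F K (n + 2)) :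
    boundary F V (n + 1) c ∈ chains F K (n + 1) := by
  classical
  refine ⟨fun u hu => ?_, ?_⟩
  · have hu' : u ∈ (Finsupp.mapDomain Fin.tail c).support := Finsupp.mem_support_iff.2 hu
    obtain ⟨v, hv, rfl⟩ := Finset.mem_image.1 (Finsupp.mapDomain_support hu')
    obtain ⟨hi, σ, hσ, e⟩ := hc.1 v (Finsupp.mem_support_iff.1 hv)
    refine ⟨hi.comp (Fin.succ_injective _), Finset.univ.image (Fin.tail v), ?_, by simp⟩
    refine (K.isRelLowerSet_faces hσ).2 ?_ (by simp)
    intro x hx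
    obtain ⟨i, -, rfl⟩ := Finset.mem_image.1 hx
    exact Finset.mem_coe.1 (e ▸ Set.mem_range_self i.succ)
  · rw [alternating_iff_mapDomain]
    intro π
    -- `π` acts on the tail; extending it by fixing entry `0` leaves the sign unchanged.
    have h := (alternating_iff_mapDomain F c).1 hc.2 (Equiv.Perm.decomposeFin.symm (0, π))
    rw [Equiv.Perm.decomposeFin.symm_sign, if_pos rfl, one_mul] at h
    rw [boundary_apply, ← Finsupp.mapDomain_smul, ← h, ← Finsupp.mapDomain_comp,
      ← Finsupp.mapDomain_comp]
    congr 1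

/-- The double boundary forgets the first two entries, and swapping them pairs tuples with opposite
coefficients. The vertices are distinct, so the pairing has no fixed points and the cancellation is
valid in characteristic two as well. -/
theorem boundary_boundary {c : (Fin (n + 2) → V) →₀ F} (hc : c ∈ chains F K (n + 2)) :
    boundary F V n (boundary F V (n + 1) c) = 0 := by
  classical
  rw [boundary_apply, boundary_apply, ← Finsupp.mapDomain_comp, Finsupp.mapDomain, Finsupp.sum]
  set τ : Equiv.Perm (Fin (n + 2)) := Equiv.swap 0 1
  have hτ : ∀ v : Fin (n + 2) → V, c (v ∘ τ) = - c v := by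
    intro v
    rw [hc.2, Equiv.Perm.sign_swap (by simp)]
    simp
  refine Finset.sum_involution (fun v _ => v ∘ τ) ?_ ?_ ?_ ?_
  · intro v _
    have : (Fin.tail ∘ Fin.tail) (v ∘ τ) = (Fin.tail ∘ Fin.tail) v := by
      ext i
      simp only [Function.comp_apply, Fin.tail]
      rw [Equiv.swap_apply_of_ne_of_ne (Fin.succ_ne_zero _)]
      rw [← Fin.succ_zero_eq_one]
      exact fun h => Fin.succ_ne_zero _ (Fin.succ_injective _ h)
    rw [this, hτ, ← Finsupp.single_add, add_neg_cancel, Finsupp.single_zero]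
  · intro v hv _ h
    have hi := (hc.1 v (Finsupp.mem_support_iff.1 hv)).1
    have := congrFun h 0
    simp only [Function.comp_apply, τ, Equiv.swap_apply_left] at this
    exact absurd (hi this) (by simp)
  · intro v hv
    rw [Finsupp.mem_support_iff] at hv ⊢
    rw [hτ]
    exact neg_ne_zero.2 hv
  · intro v _
    ext i
    simp [τ]

theorem cycles_le_chains (K : PreAbstractSimplicialComplex V) :
    ∀ k, cycles F K k ≤ chains F K (k + 1)
  | 0 => le_rfl
  | _ + 1 => inf_le_left

theorem boundaries_le_cycles (K : PreAbstractSimplicialComplex V) :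
    ∀ k, boundaries F K k ≤ cycles F K k := by
  intro k
  rintro _ ⟨c, hc, rfl⟩
  cases k with
  | zero => exact boundary_mem_chains F hc
  | succ k => exact ⟨boundary_mem_chains F hc, boundary_boundary F hc⟩

theorem cycles_eq_inf (h : L ≤ K) (k : ℕ) : cycles F L k = cycles F K k ⊓ chains F L (k + 1) := by
  cases k with
  | zero => exact (inf_eq_right.2 (chains_mono F h 1)).symm
  | succ k =>
    simp only [cycles]
    rw [inf_right_comm, inf_eq_right.2 (chains_mono F h (k + 2))]

theorem betti_add_finrank_boundaries (hK : K.faces.Finite) (k : ℕ) :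
    betti F K k + Module.finrank F (boundaries F K k) = Module.finrank F (cycles F K k) := by
  have := finiteDimensional_chains F hK (k + 1)
  have : FiniteDimensional F (cycles F K k) :=
    Submodule.finiteDimensional_of_le (cycles_le_chains F K k)
  exact finrank_quotientSpace (boundaries_le_cycles F K k)

/-- The dimension formula for the cycles of `K` and the chains of `L`: they meet in the cycles of
`L`, and their sum lies in the chains of `K`. -/
theorem finrank_cycles_add_le (hK : K.faces.Finite) (h : L ≤ K) (k : ℕ) :
    Module.finrank F (cycles F K k) + Module.finrank F (chains F L (k + 1)) ≤
      Module.finrank F (cycles F L k) + Module.finrank F (chains F K (k + 1)) := by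
  have := finiteDimensional_chains F hK (k + 1)
  have := finiteDimensional_chains F (hK.subset h) (k + 1)
  have : FiniteDimensional F (cycles F K k) :=
    Submodule.finiteDimensional_of_le (cycles_le_chains F K k)
  have h1 := Submodule.finrank_sup_add_finrank_inf_eq (cycles F K k) (chains F L (k + 1))
  rw [← cycles_eq_inf F h] at h1
  have h2 := Submodule.finrank_mono (sup_le (cycles_le_chains F K k) (chains_mono F h (k + 1)))
  omega

theorem finrank_boundaries_add_le (hK : K.faces.Finite) (h : L ≤ K) (k : ℕ) :
    Module.finrank F (boundaries F K k) + Module.finrank F (chains F L (k + 2)) ≤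
      Module.finrank F (boundaries F L k) + Module.finrank F (chains F K (k + 2)) := by
  have := finiteDimensional_chains F hK (k + 2)
  exact finrank_map_add_le (chains_mono F h (k + 2)) (boundary F V (k + 1))

theorem finrank_boundaries_mono (hK : K.faces.Finite) (h : L ≤ K) (k : ℕ) :
    Module.finrank F (boundaries F L k) ≤ Module.finrank F (boundaries F K k) := by
  have := finiteDimensional_chains F hK (k + 2)
  have : FiniteDimensional F (boundaries F K k) := by unfold boundaries; infer_instance
  exact Submodule.finrank_mono (Submodule.map_mono (chains_mono F h (k + 2)))

theorem finrank_cycles_mono (hK : K.faces.Finite) (h : L ≤ K) (k : ℕ) :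
    Module.finrank F (cycles F L k) ≤ Module.finrank F (cycles F K k) := by
  have := finiteDimensional_chains F hK (k + 1)
  have : FiniteDimensional F (cycles F K k) :=
    Submodule.finiteDimensional_of_le (cycles_le_chains F K k)
  exact Submodule.finrank_mono (cycles_eq_inf F h k ▸ inf_le_left)

theorem finrank_chains_mono (hK : K.faces.Finite) (h : L ≤ K) (n : ℕ) :
    Module.finrank F (chains F L n) ≤ Module.finrank F (chains F K n) := by
  have := finiteDimensional_chains F hK n
  exact Submodule.finrank_mono (chains_mono F h n)

end Chains

/-! ### Additivity over vertex-disjoint unions -/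

section Disjoint

variable (F : Type*) [Field F] {V : Type*} {A B : PreAbstractSimplicialComplex V}

/-- No vertex belongs to both complexes. -/
def VertexDisjoint (A B : PreAbstractSimplicialComplex V) : Prop :=
  ∀ σ ∈ A, ∀ τ ∈ B, Disjoint σ τ

theorem orderedSimplices_sup (A B : PreAbstractSimplicialComplex V) (n : ℕ) :
    orderedSimplices (A ⊔ B) n = orderedSimplices A n ∪ orderedSimplices B n := by
  ext v
  constructor
  · rintro ⟨hi, σ, hσ | hσ, e⟩
    · exact Or.inl ⟨hi, σ, hσ, e⟩
    · exact Or.inr ⟨hi, σ, hσ, e⟩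
  · rintro (⟨hi, σ, hσ, e⟩ | ⟨hi, σ, hσ, e⟩)
    · exact ⟨hi, σ, Or.inl hσ, e⟩
    · exact ⟨hi, σ, Or.inr hσ, e⟩

/-- Split a chain into its part on the ordered simplices of `A` and the rest. That set is invariant
under permutations of the entries, so both parts remain alternating. -/
theorem chains_sup (A B : PreAbstractSimplicialComplex V) (n : ℕ) :
    chains F (A ⊔ B) n = chains F A n ⊔ chains F B n := by
  classical
  refine le_antisymm (fun c hc => ?_) (sup_le (chains_mono F le_sup_left n)
    (chains_mono F le_sup_right n))
  rw [mem_chains] at hc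
  rw [← Finsupp.filter_add_filter_not c (· ∈ orderedSimplices A n)]
  refine Submodule.add_mem_sup ⟨fun v hv => ?_, fun v π => ?_⟩ ⟨fun v hv => ?_, fun v π => ?_⟩
  · by_contra h
    exact hv (Finsupp.filter_apply_neg _ _ h)
  · simp only [Finsupp.filter_apply, orderedSimplices_comp_perm, hc.2 v π, mul_ite, mul_zero]
  · have hA : v ∉ orderedSimplices A n := by
      intro h
      exact hv (Finsupp.filter_apply_neg _ _ (not_not.2 h))
    have := hc.1 v fun h0 => hv (by simp [Finsupp.filter_apply, h0])
    rw [orderedSimplices_sup] at this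
    exact this.resolve_left hA
  · simp only [Finsupp.filter_apply, orderedSimplices_comp_perm, hc.2 v π, mul_ite, mul_zero]

theorem chains_inf (h : VertexDisjoint A B) (n : ℕ) : chains F A n ⊓ chains F B n = ⊥ := by
  rw [eq_bot_iff]
  rintro c ⟨hA, hB⟩
  rw [Submodule.mem_bot]
  ext v
  by_contra hv
  obtain ⟨-, σ, hσ, e⟩ := hA.1 v hv
  obtain ⟨-, τ, hτ, e'⟩ := hB.1 v hv
  have hst : σ = τ := Finset.coe_injective (e.trans e'.symm)
  subst hst
  have := h σ hσ σ hτ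
  rw [disjoint_self] at this
  exact (A.isRelLowerSet_faces hσ).1.ne_empty this

/-- If `a + b` is a cycle, then `∂a = -∂b` is a chain of both complexes, hence zero. -/
theorem cycles_sup (h : VertexDisjoint A B) (k : ℕ) :
    cycles F (A ⊔ B) k = cycles F A k ⊔ cycles F B k := by
  cases k with
  | zero => exact chains_sup F A B 1
  | succ k =>
    refine le_antisymm ?_ (sup_le ?_ ?_)
    · rintro c ⟨hc, hk⟩
      rw [SetLike.mem_coe, chains_sup, Submodule.mem_sup] at hc
      obtain ⟨a, ha, b, hb, rfl⟩ := hc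
      have hk' : boundary F V (k + 1) a + boundary F V (k + 1) b = 0 := by
        rw [← map_add]; exact hk
      have ha' := boundary_mem_chains F ha
      have hb' := boundary_mem_chains F hb
      have h0 : boundary F V (k + 1) a = 0 := by
        rw [← Submodule.mem_bot F, ← chains_inf F h (k + 1)]
        refine ⟨ha', ?_⟩
        rw [eq_neg_of_add_eq_zero_left hk']
        exact Submodule.neg_mem _ hb'
      rw [h0, zero_add] at hk'
      exact Submodule.add_mem_sup ⟨ha, h0⟩ ⟨hb, hk'⟩
    · rw [cycles_eq_inf F (le_sup_left : A ≤ A ⊔ B)]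
      exact inf_le_left
    · rw [cycles_eq_inf F (le_sup_right : B ≤ A ⊔ B)]
      exact inf_le_left

theorem boundaries_sup (A B : PreAbstractSimplicialComplex V) (k : ℕ) :
    boundaries F (A ⊔ B) k = boundaries F A k ⊔ boundaries F B k := by
  simp only [boundaries, chains_sup, Submodule.map_sup]

theorem finrank_chains_sup (hA : A.faces.Finite) (hB : B.faces.Finite) (h : VertexDisjoint A B)
    (n : ℕ) : Module.finrank F (chains F (A ⊔ B) n) =
      Module.finrank F (chains F A n) + Module.finrank F (chains F B n) := by
  have := finiteDimensional_chains F hA n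
  have := finiteDimensional_chains F hB n
  rw [← Submodule.finrank_sup_add_finrank_inf_eq, chains_inf F h, finrank_bot, add_zero,
    chains_sup]

theorem betti_sup (hA : A.faces.Finite) (hB : B.faces.Finite) (h : VertexDisjoint A B) (k : ℕ) :
    betti F (A ⊔ B) k = betti F A k + betti F B k := by
  have := finiteDimensional_chains F hA (k + 1)
  have := finiteDimensional_chains F hB (k + 1)
  have : FiniteDimensional F (cycles F A k) :=
    Submodule.finiteDimensional_of_le (cycles_le_chains F A k)
  have : FiniteDimensional F (cycles F B k) :=
    Submodule.finiteDimensional_of_le (cycles_le_chains F B k)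
  have : FiniteDimensional F (boundaries F A k) :=
    Submodule.finiteDimensional_of_le (boundaries_le_cycles F A k)
  have : FiniteDimensional F (boundaries F B k) :=
    Submodule.finiteDimensional_of_le (boundaries_le_cycles F B k)
  have hZ : cycles F A k ⊓ cycles F B k = ⊥ := by
    rw [eq_bot_iff, ← chains_inf F h (k + 1)]
    exact inf_le_inf (cycles_le_chains F A k) (cycles_le_chains F B k)
  have hBd : boundaries F A k ⊓ boundaries F B k = ⊥ := by
    rw [eq_bot_iff, ← hZ]
    exact inf_le_inf (boundaries_le_cycles F A k) (boundaries_le_cycles F B k)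
  have h1 := betti_add_finrank_boundaries F hA k
  have h2 := betti_add_finrank_boundaries F hB k
  have h3 := betti_add_finrank_boundaries F (K := A ⊔ B) (hA.union hB) k
  have h4 := Submodule.finrank_sup_add_finrank_inf_eq (cycles F A k) (cycles F B k)
  have h5 := Submodule.finrank_sup_add_finrank_inf_eq (boundaries F A k) (boundaries F B k)
  rw [hZ, finrank_bot, ← cycles_sup F h] at h4
  rw [hBd, finrank_bot, ← boundaries_sup] at h5
  omega

end Disjoint

/-! ### Invariance under injective relabelling of vertices -/

section Relabel

open scoped Classical in
theorem orderedSimplices_map {V W : Type*} (K : PreAbstractSimplicialComplex V) {f : V → W}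
    (hf : Function.Injective f) (n : ℕ) :
    orderedSimplices (K.map f) n = (fun v => f ∘ v) '' orderedSimplices K n := by
  ext w
  constructor
  · rintro ⟨hi, _, ⟨σ, hσ, rfl⟩, e⟩
    have : ∀ i, ∃ x ∈ σ, f x = w i := by
      intro i
      have : w i ∈ ((σ.image f : Finset W) : Set W) := e ▸ Set.mem_range_self i
      simpa using this
    choose v hv hvw using this
    obtain rfl : f ∘ v = w := funext hvw
    refine ⟨v, ⟨hi.of_comp, σ, hσ, ?_⟩, rfl⟩
    rw [Finset.coe_image, Set.range_comp] at e
    exact hf.image_injective e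
  · rintro ⟨v, ⟨hi, σ, hσ, e⟩, rfl⟩
    refine ⟨hf.comp hi, σ.image f, ⟨σ, hσ, rfl⟩, ?_⟩
    rw [Finset.coe_image, e, Set.range_comp]

variable (F : Type*) [Field F] {V W : Type*} (K : PreAbstractSimplicialComplex V) {f : V → W}

open scoped Classical in
theorem chains_map (hf : Function.Injective f) (n : ℕ) :
    chains F (K.map f) n = (chains F K n).map (Finsupp.lmapDomain F F (fun v => f ∘ v)) := by
  have hf' : Function.Injective (fun v : Fin n → V => f ∘ v) := hf.comp_left
  ext c
  constructor
  · intro hc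
    rw [mem_chains, orderedSimplices_map K hf] at hc
    have hr : (c.support : Set (Fin n → W)) ⊆ Set.range (fun v : Fin n → V => f ∘ v) := by
      intro w hw
      obtain ⟨v, -, rfl⟩ := hc.1 w (by simpa using hw)
      exact ⟨v, rfl⟩
    refine ⟨Finsupp.comapDomain (fun v => f ∘ v) c hf'.injOn, ⟨fun v hv => ?_, fun v π => ?_⟩,
      Finsupp.mapDomain_comapDomain _ hf' c hr⟩
    · obtain ⟨v', hv', e⟩ := hc.1 _ hv
      exact hf' e ▸ hv'
    · exact hc.2 (f ∘ v) π
  · rintro ⟨c, hc, rfl⟩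
    rw [mem_chains, orderedSimplices_map K hf]
    refine ⟨fun w hw => ?_, ?_⟩
    · have hw' : w ∈ (Finsupp.mapDomain (fun v => f ∘ v) c).support := Finsupp.mem_support_iff.2 hw
      obtain ⟨v, hv, rfl⟩ := Finset.mem_image.1 (Finsupp.mapDomain_support hw')
      exact ⟨v, hc.1 v (Finsupp.mem_support_iff.1 hv), rfl⟩
    · rw [alternating_iff_mapDomain]
      intro π
      rw [Finsupp.lmapDomain_apply, ← Finsupp.mapDomain_smul,
        ← (alternating_iff_mapDomain F c).1 hc.2 π, ← Finsupp.mapDomain_comp,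
        ← Finsupp.mapDomain_comp]
      rfl

theorem boundary_mapDomain (n : ℕ) (c : (Fin (n + 1) → V) →₀ F) :
    boundary F W n (Finsupp.lmapDomain F F (fun v => f ∘ v) c) =
      Finsupp.lmapDomain F F (fun v => f ∘ v) (boundary F V n c) := by
  simp only [boundary, Finsupp.lmapDomain_apply, ← Finsupp.mapDomain_comp]
  rfl

theorem lmapDomain_comp_injective (hf : Function.Injective f) (n : ℕ) :
    Function.Injective (Finsupp.lmapDomain F F (fun v : Fin n → V => f ∘ v)) :=
  Finsupp.mapDomain_injective hf.comp_left

open scoped Classical in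
theorem cycles_map (hf : Function.Injective f) (k : ℕ) :
    cycles F (K.map f) k = (cycles F K k).map (Finsupp.lmapDomain F F (fun v => f ∘ v)) := by
  cases k with
  | zero => exact chains_map F K hf 1
  | succ k =>
    simp only [cycles]
    rw [chains_map F K hf]
    ext c
    constructor
    · rintro ⟨⟨c, hc, rfl⟩, hk⟩
      refine ⟨c, ⟨hc, ?_⟩, rfl⟩
      rw [SetLike.mem_coe, LinearMap.mem_ker, boundary_mapDomain] at hk
      exact lmapDomain_comp_injective F hf _ (hk.trans (map_zero _).symm)
    · rintro ⟨c, ⟨hc, hk⟩, rfl⟩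
      refine ⟨⟨c, hc, rfl⟩, ?_⟩
      rw [SetLike.mem_coe, LinearMap.mem_ker, boundary_mapDomain, LinearMap.mem_ker.1 hk, map_zero]

open scoped Classical in
theorem boundaries_map (hf : Function.Injective f) (k : ℕ) :
    boundaries F (K.map f) k =
      (boundaries F K k).map (Finsupp.lmapDomain F F (fun v => f ∘ v)) := by
  simp only [boundaries]
  rw [chains_map F K hf, ← Submodule.map_comp, ← Submodule.map_comp]
  congr 1
  ext1 c
  exact LinearMap.ext fun _ => boundary_mapDomain F _ _

open scoped Classical in
theorem finrank_chains_map (hf : Function.Injective f) (n : ℕ) :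
    Module.finrank F (chains F (K.map f) n) = Module.finrank F (chains F K n) := by
  rw [chains_map F K hf]
  exact finrank_map_of_injective _ (lmapDomain_comp_injective F hf n)

open scoped Classical in
theorem betti_map (hK : K.faces.Finite) (hf : Function.Injective f) (k : ℕ) :
    betti F (K.map f) k = betti F K k := by
  have h1 := betti_add_finrank_boundaries F hK k
  have h2 := betti_add_finrank_boundaries F (K := K.map f) (hK.image _) k
  rw [cycles_map F K hf, boundaries_map F K hf] at h2
  have h3 : Module.finrank F ((cycles F K k).map (Finsupp.lmapDomain F F (fun v => f ∘ v))) =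
      Module.finrank F (cycles F K k) :=
    finrank_map_of_injective _ (lmapDomain_comp_injective F hf _)
  have h4 : Module.finrank F ((boundaries F K k).map (Finsupp.lmapDomain F F (fun v => f ∘ v))) =
      Module.finrank F (boundaries F K k) :=
    finrank_map_of_injective _ (lmapDomain_comp_injective F hf _)
  omega

end Relabel

/-! ### Almost additive functionals, and the Betti number as a difference of two -/

section AlmostAdditive

variable {V : Type*}

/-- A numerical functional of finite complexes that is monotone, additive over vertex-disjoint
unions, invariant under relabelling of the vertices, and whose increments are controlled by the
numbers of new ordered simplices with `k + 1` and with `k + 2` vertices. -/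
structure IsAlmostAdditive (G : PreAbstractSimplicialComplex V → ℕ) (k : ℕ) : Prop where
  mono : ∀ K L, K.faces.Finite → L ≤ K → G L ≤ G K
  sup : ∀ A B, A.faces.Finite → B.faces.Finite → VertexDisjoint A B → G (A ⊔ B) = G A + G B
  map : ∀ (f : V → V) (K : PreAbstractSimplicialComplex V) [DecidableEq V], K.faces.Finite →
    Set.InjOn f {x | ∃ σ ∈ K, x ∈ σ} → G (K.map f) = G K
  le_add : ∀ K L, K.faces.Finite → L ≤ K →
    G K ≤ G L + 2 * ((orderedSimplices K (k + 1) \ orderedSimplices L (k + 1)).ncard +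
      (orderedSimplices K (k + 2) \ orderedSimplices L (k + 2)).ncard)

/-- The complex `K` seen on a set `S` of vertices. -/
def comapSubtype (K : PreAbstractSimplicialComplex V) (S : Set V) :
    PreAbstractSimplicialComplex S where
  faces := {τ | τ.map (Function.Embedding.subtype _) ∈ K}
  isRelLowerSet_faces := by
    intro τ hτ
    refine ⟨Finset.map_nonempty.1 (K.isRelLowerSet_faces hτ).1, fun τ' h hne => ?_⟩
    exact (K.isRelLowerSet_faces hτ).2 (Finset.map_subset_map.2 h) (Finset.map_nonempty.2 hne)

theorem finite_faces_comapSubtype {K : PreAbstractSimplicialComplex V} (hK : K.faces.Finite)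
    (S : Set V) : (comapSubtype K S).faces.Finite :=
  hK.preimage (Finset.map_injective _).injOn

theorem map_comapSubtype [DecidableEq V] (K : PreAbstractSimplicialComplex V) {S : Set V}
    (hS : ∀ σ ∈ K, ∀ x ∈ σ, x ∈ S) {W : Type*} [DecidableEq W] (f : V → W) :
    (comapSubtype K S).map (fun x => f x) = K.map f := by
  classical
  ext ρ
  constructor
  · rintro ⟨τ, hτ, rfl⟩
    refine ⟨_, hτ, ?_⟩
    ext x
    simp
  · rintro ⟨σ, hσ, rfl⟩
    refine ⟨σ.subtype (· ∈ S), ?_, ?_⟩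
    · change (σ.subtype (· ∈ S)).map (Function.Embedding.subtype _) ∈ K
      rw [Finset.subtype_map_of_mem (hS σ hσ)]
      exact hσ
    · ext x
      simp only [Finset.mem_image, Subtype.exists]
      constructor
      · rintro ⟨y, hy, hy', rfl⟩
        exact ⟨y, Finset.mem_subtype.1 hy', rfl⟩
      · rintro ⟨y, hy, rfl⟩
        exact ⟨y, hS σ hσ y hy, Finset.mem_subtype.2 hy, rfl⟩

theorem map_id_complex [DecidableEq V] (K : PreAbstractSimplicialComplex V) :
    K.map (fun x => x) = K := by
  ext ρ
  simp [PreAbstractSimplicialComplex.map]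

variable (F : Type*) [Field F]

/-- Once `K` is seen on its own vertex set, `f` becomes injective; then `K` and its image are both
injective relabellings of the same complex. -/
theorem finrank_chains_map_of_injOn [DecidableEq V] {K : PreAbstractSimplicialComplex V}
    {f : V → V} (hf : Set.InjOn f {x | ∃ σ ∈ K, x ∈ σ}) (n : ℕ) :
    Module.finrank F (chains F (K.map f) n) = Module.finrank F (chains F K n) := by
  have hS : ∀ σ ∈ K, ∀ x ∈ σ, x ∈ {x | ∃ σ ∈ K, x ∈ σ} := fun σ hσ x hx => ⟨σ, hσ, hx⟩
  have h1 := finrank_chains_map F (comapSubtype K {x | ∃ σ ∈ K, x ∈ σ})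
    (f := fun x => f x) hf.injective n
  have h2 := finrank_chains_map F (comapSubtype K {x | ∃ σ ∈ K, x ∈ σ})
    (f := fun x => (x : V)) Subtype.val_injective n
  rw [← map_comapSubtype K hS f]
  conv_rhs => rw [← map_id_complex K, ← map_comapSubtype K hS (fun x => x)]
  convert h1.trans h2.symm

theorem betti_map_of_injOn [DecidableEq V] {K : PreAbstractSimplicialComplex V}
    (hK : K.faces.Finite)
    {f : V → V} (hf : Set.InjOn f {x | ∃ σ ∈ K, x ∈ σ}) (k : ℕ) :
    betti F (K.map f) k = betti F K k := by
  have hS : ∀ σ ∈ K, ∀ x ∈ σ, x ∈ {x | ∃ σ ∈ K, x ∈ σ} := fun σ hσ x hx => ⟨σ, hσ, hx⟩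
  have h1 := betti_map F (comapSubtype K {x | ∃ σ ∈ K, x ∈ σ})
    (finite_faces_comapSubtype hK _) (f := fun x => f x) hf.injective k
  have h2 := betti_map F (comapSubtype K {x | ∃ σ ∈ K, x ∈ σ})
    (finite_faces_comapSubtype hK _) (f := fun x => (x : V)) Subtype.val_injective k
  rw [← map_comapSubtype K hS f]
  conv_rhs => rw [← map_id_complex K, ← map_comapSubtype K hS (fun x => x)]
  convert h1.trans h2.symm

/-- The number of simplices of dimensions `k` and `k + 1`. -/
def simplexCount (k : ℕ) (K : PreAbstractSimplicialComplex V) : ℕ :=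
  Module.finrank F (chains F K (k + 1)) + Module.finrank F (chains F K (k + 2))

theorem isAlmostAdditive_simplexCount (k : ℕ) :
    IsAlmostAdditive (simplexCount F k : PreAbstractSimplicialComplex V → ℕ) k where
  mono K L hK h := Nat.add_le_add (finrank_chains_mono F hK h _) (finrank_chains_mono F hK h _)
  sup A B hA hB h := by
    simp only [simplexCount, finrank_chains_sup F hA hB h]
    ring
  map f K _ hK hf := by
    simp only [simplexCount, finrank_chains_map_of_injOn F hf]
  le_add K L hK h := by
    have h1 := finrank_chains_le F hK h (k + 1)
    have h2 := finrank_chains_le F hK h (k + 2)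
    simp only [simplexCount]
    omega

/-- Monotone because any growth of the boundaries, which lowers `β`, is compensated by the growth of
the chains on `k + 2` vertices. -/
theorem isAlmostAdditive_betti_add_simplexCount (k : ℕ) :
    IsAlmostAdditive
      (fun K : PreAbstractSimplicialComplex V => betti F K k + simplexCount F k K) k where
  mono K L hK h := by
    have h1 := finrank_chains_mono F hK h (k + 1)
    have h2 := finrank_cycles_mono F hK h k
    have h3 := finrank_boundaries_add_le F hK h k
    have h4 := betti_add_finrank_boundaries F hK k
    have h5 := betti_add_finrank_boundaries F (hK.subset h) k
    simp only [simplexCount]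
    omega
  sup A B hA hB h := by
    simp only [(isAlmostAdditive_simplexCount F k).sup A B hA hB h, betti_sup F hA hB h]
    ring
  map f K _ hK hf := by
    rw [(isAlmostAdditive_simplexCount F k).map f K hK hf, betti_map_of_injOn F hK hf]
  -- New ordered simplices on `k + 1` vertices count twice, once through the cycles and once through
  -- the simplex count; hence the factor `2` in `IsAlmostAdditive`.
  le_add K L hK h := by
    have h1 := finrank_chains_le F hK h (k + 1)
    have h2 := finrank_chains_le F hK h (k + 2)
    have h3 := finrank_cycles_add_le F hK h k
    have h4 := finrank_boundaries_mono F hK h k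
    have h5 := betti_add_finrank_boundaries F hK k
    have h6 := betti_add_finrank_boundaries F (hK.subset h) k
    simp only [simplexCount]
    omega

end AlmostAdditive

/-! ### Čech complexes: monotonicity, diameter, isometries, stability in the radius -/

section Cech

variable {E : Type*} [PseudoMetricSpace E]

theorem mem_cech {X : Set E} {r : ℝ} {σ : Finset E} :
    σ ∈ cech X r ↔ σ.Nonempty ∧ (σ : Set E) ⊆ X ∧ ∃ y, ∀ x ∈ σ, dist y x ≤ r := by
  change (σ.Nonempty ∧ (σ : Set E) ⊆ X ∧ (⋂ x ∈ σ, Metric.closedBall x r).Nonempty) ↔ _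
  simp only [Set.Nonempty, Set.mem_iInter, Metric.mem_closedBall]

theorem cech_mono {X Y : Set E} (h : X ⊆ Y) (r : ℝ) : cech X r ≤ cech Y r := by
  intro σ hσ
  obtain ⟨h1, h2, h3⟩ := mem_cech.1 hσ
  exact mem_cech.2 ⟨h1, h2.trans h, h3⟩

theorem finite_faces_cech {X : Set E} (hX : X.Finite) (r : ℝ) : (cech X r).faces.Finite := by
  refine (Set.Finite.subset hX.toFinset.powerset.finite_toSet) ?_
  intro σ hσ
  simpa [← Finset.coe_subset] using (mem_cech.1 hσ).2.1

theorem injOn_vertices_cech {X : Set E} {r : ℝ} {f : E → E} (hf : Set.InjOn f X) :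
    Set.InjOn f {x | ∃ σ ∈ cech X r, x ∈ σ} := by
  refine hf.mono ?_
  rintro x ⟨σ, hσ, hx⟩
  exact (mem_cech.1 hσ).2.1 hx

theorem dist_le_of_mem_orderedSimplices {X : Set E} {r : ℝ} {n : ℕ} {v : Fin n → E}
    (hv : v ∈ orderedSimplices (cech X r) n) (i j : Fin n) : dist (v i) (v j) ≤ 2 * r := by
  obtain ⟨-, σ, hσ, e⟩ := hv
  obtain ⟨-, -, y, hy⟩ := mem_cech.1 hσ
  have hi := hy (v i) (Finset.mem_coe.1 (e ▸ Set.mem_range_self i))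
  have hj := hy (v j) (Finset.mem_coe.1 (e ▸ Set.mem_range_self j))
  calc dist (v i) (v j) ≤ dist y (v i) + dist y (v j) := dist_triangle_left _ _ _
    _ ≤ 2 * r := by linarith

theorem mem_of_mem_orderedSimplices {X : Set E} {r : ℝ} {n : ℕ} {v : Fin n → E}
    (hv : v ∈ orderedSimplices (cech X r) n) (i : Fin n) : v i ∈ X := by
  obtain ⟨-, σ, hσ, e⟩ := hv
  exact (mem_cech.1 hσ).2.1 (e ▸ Set.mem_range_self i)

theorem map_cech_of_isometryEquiv [DecidableEq E] (X : Set E) (r : ℝ) (f : E ≃ᵢ E) :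
    (cech X r).map f = cech (f '' X) r := by
  ext ρ
  constructor
  · rintro ⟨σ, hσ, rfl⟩
    obtain ⟨h1, h2, y, hy⟩ := mem_cech.1 hσ
    refine mem_cech.2 ⟨h1.image f, ?_, f y, ?_⟩
    · rw [Finset.coe_image]
      exact Set.image_mono h2
    · intro x hx
      obtain ⟨x, hx', rfl⟩ := Finset.mem_image.1 hx
      rw [f.dist_eq]
      exact hy x hx'
  · intro hρ
    obtain ⟨h1, h2, y, hy⟩ := mem_cech.1 hρ
    refine ⟨ρ.image f.symm, mem_cech.2 ⟨h1.image _, ?_, f.symm y, ?_⟩, ?_⟩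
    · intro x hx
      rw [Finset.coe_image] at hx
      obtain ⟨z, hz, rfl⟩ := hx
      obtain ⟨w, hw, rfl⟩ := h2 hz
      simpa using hw
    · intro x hx
      obtain ⟨x, hx', rfl⟩ := Finset.mem_image.1 hx
      rw [f.symm.dist_eq]
      exact hy x hx'
    · ext x
      simp

/-- Otherwise the intersections of the balls with radii decreasing to `r` would be nested nonempty
compact sets, and a common point of them would work for `r` itself. -/
theorem exists_pos_forall_not_dist_le [ProperSpace E] {σ : Finset E} (hσ : σ.Nonempty) {r : ℝ}
    (h : ¬ ∃ y, ∀ x ∈ σ, dist y x ≤ r) : ∃ ε > 0, ¬ ∃ y, ∀ x ∈ σ, dist y x ≤ r + ε := by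
  by_contra! hcon
  let t : ℕ → Set E := fun i => ⋂ x ∈ σ, Metric.closedBall x (r + 1 / ((i : ℝ) + 1))
  have hcl : ∀ i, IsClosed (t i) := fun i => isClosed_biInter fun x _ => Metric.isClosed_closedBall
  have hne : (⋂ i, t i).Nonempty := by
    refine IsCompact.nonempty_iInter_of_sequence_nonempty_isCompact_isClosed t ?_ ?_ ?_ hcl
    · intro i
      refine Set.iInter₂_mono fun x _ => Metric.closedBall_subset_closedBall ?_
      gcongr
      simp
    · intro i
      obtain ⟨y, hy⟩ := hcon (1 / ((i : ℝ) + 1)) (by positivity)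
      exact ⟨y, by simpa [t] using hy⟩
    · obtain ⟨x, hx⟩ := hσ
      exact (isCompact_closedBall x (r + 1 / (((0 : ℕ) : ℝ) + 1))).of_isClosed_subset (hcl 0)
        (Set.iInter₂_subset x hx)
  obtain ⟨y, hy⟩ := hne
  refine h ⟨y, fun x hx => ?_⟩
  have hle : ∀ i : ℕ, dist y x ≤ r + 1 / ((i : ℝ) + 1) := by
    intro i
    have := Set.mem_iInter.1 hy i
    simp only [t, Set.mem_iInter] at this
    exact this x hx
  have hlim : Tendsto (fun i : ℕ => r + 1 / ((i : ℝ) + 1)) atTop (𝓝 (r + 0)) :=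
    tendsto_const_nhds.add tendsto_one_div_add_atTop_nhds_zero_nat
  rw [add_zero] at hlim
  exact ge_of_tendsto' hlim hle

end Cech

/-! ### Moving the vertices slightly does not change the complex -/

section Discretization

variable {E : Type*} [MetricSpace E]

/-- Enlarging the radius by the displacement keeps every simplex. Conversely, each of the finitely
many non-simplices has a positive margin, so small displacements create no new simplex. -/
theorem eventually_map_cech [ProperSpace E] [DecidableEq E] {X : Set E} (hX : X.Finite) (r : ℝ)
    {p : ℕ → E → E} {δ : ℕ → ℝ} (hδ : Tendsto δ atTop (𝓝 0))
    (hp : ∀ m x, dist (p m x) x ≤ δ m) :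
    ∀ᶠ m in atTop, Set.InjOn (p m) X ∧ (cech X r).map (p m) = cech (p m '' X) (r + δ m) := by
  have hinj : ∀ᶠ m in atTop, ∀ x ∈ X, ∀ y ∈ X, p m x = p m y → x = y := by
    refine (eventually_all_finite hX).2 fun x _ => (eventually_all_finite hX).2 fun y _ => ?_
    by_cases hxy : x = y
    · exact Eventually.of_forall fun _ _ => hxy
    have : ∀ᶠ m in atTop, δ m < dist x y / 2 := hδ.eventually_lt_const (by
      have := dist_pos.2 hxy
      positivity)
    filter_upwards [this] with m hm he
    have h1 := dist_triangle_left x y (p m x)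
    have h2 := hp m x
    have h3 := hp m y
    rw [← he] at h3
    linarith
  have hface : ∀ᶠ m in atTop, ∀ σ ∈ (hX.toFinset.powerset : Set (Finset E)), σ.Nonempty →
      (∃ y, ∀ x ∈ σ.image (p m), dist y x ≤ r + δ m) → ∃ y, ∀ x ∈ σ, dist y x ≤ r := by
    refine (eventually_all_finite (Finset.finite_toSet _)).2 fun σ _ => ?_
    by_cases hne : σ.Nonempty
    swap
    · exact Eventually.of_forall fun _ h => absurd h hne
    by_cases h : ∃ y, ∀ x ∈ σ, dist y x ≤ r
    · exact Eventually.of_forall fun _ _ _ => h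
    obtain ⟨ε, hε, hno⟩ := exists_pos_forall_not_dist_le hne h
    -- `δ m` is paid twice, for the enlarged radius and for the displacement, so it must be below `ε
    -- / 2`.
    filter_upwards [hδ.eventually_lt_const (half_pos hε)] with m hm _ ⟨y, hy⟩
    refine absurd ⟨y, fun x hx => ?_⟩ hno
    have h1 := hy _ (Finset.mem_image_of_mem _ hx)
    have h2 := dist_triangle y (p m x) x
    have h3 := hp m x
    linarith
  filter_upwards [hinj, hface] with m h1 h2
  refine ⟨fun x hx y hy h => h1 x hx y hy h, ?_⟩
  ext ρ
  constructor
  · rintro ⟨σ, hσ, rfl⟩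
    obtain ⟨hne, hs, y, hy⟩ := mem_cech.1 hσ
    refine mem_cech.2 ⟨hne.image _, ?_, y, ?_⟩
    · rw [Finset.coe_image]
      exact Set.image_mono hs
    · intro x hx
      obtain ⟨x, hx', rfl⟩ := Finset.mem_image.1 hx
      have h3 := dist_triangle_right y (p m x) x
      have h4 := hp m x
      have h5 := hy x hx'
      linarith
  · intro hρ
    obtain ⟨hne, hs, hy⟩ := mem_cech.1 hρ
    obtain ⟨σ, hσ, rfl⟩ := Finset.subset_set_image_iff.1 hs
    exact ⟨σ, mem_cech.2 ⟨Finset.image_nonempty.1 hne, hσ,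
      h2 σ (by simpa [← Finset.coe_subset] using hσ) (Finset.image_nonempty.1 hne) hy⟩, rfl⟩

end Discretization

/-! ### Atoms of counting measures, and translations -/

section Points

variable {d : ℕ}

theorem measure_lt_top_of_isBounded (φ : CountingMeasure d) {B : Set (EuclideanSpace ℝ (Fin d))}
    (hb : Bornology.IsBounded B) : φ.1 B < ⊤ := by
  obtain ⟨R, hR⟩ := hb.subset_closedBall 0
  obtain ⟨n, hn⟩ := φ.2 _ Metric.isClosed_closedBall.measurableSet
    (Metric.isBounded_closedBall (x := (0 : EuclideanSpace ℝ (Fin d))) (r := R))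
  exact (measure_mono hR).trans_lt (hn ▸ ENNReal.natCast_lt_top n)

theorem one_le_measure_singleton {φ : CountingMeasure d} {x : EuclideanSpace ℝ (Fin d)}
    (hx : x ∈ points φ) : 1 ≤ φ.1 {x} := by
  obtain ⟨n, hn⟩ := φ.2 {x} (measurableSet_singleton x) Bornology.isBounded_singleton
  have hx' : φ.1 {x} ≠ 0 := hx
  rw [hn] at hx' ⊢
  exact_mod_cast Nat.one_le_iff_ne_zero.2 (by exact_mod_cast hx')

theorem card_le_measure {φ : CountingMeasure d} {B : Set (EuclideanSpace ℝ (Fin d))}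
    {s : Finset (EuclideanSpace ℝ (Fin d))} (hs : (s : Set _) ⊆ points φ ∩ B) :
    (s.card : ENNReal) ≤ φ.1 B :=
  calc (s.card : ENNReal) = ∑ x ∈ s, 1 := by simp
    _ ≤ ∑ x ∈ s, φ.1 {x} := Finset.sum_le_sum fun x hx => one_le_measure_singleton (hs hx).1
    _ = φ.1 s := sum_measure_singleton
    _ ≤ φ.1 B := measure_mono fun x hx => (hs hx).2

theorem finite_points_inter (φ : CountingMeasure d) {B : Set (EuclideanSpace ℝ (Fin d))}
    (hb : Bornology.IsBounded B) : (points φ ∩ B).Finite := by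
  by_contra h
  have : ∀ n : ℕ, (n : ENNReal) ≤ φ.1 B := by
    intro n
    obtain ⟨s, hs, hn⟩ := Set.Infinite.exists_subset_card_eq h n
    exact hn ▸ card_le_measure hs
  exact (measure_lt_top_of_isBounded φ hb).ne (ENNReal.eq_top_of_forall_nnreal_le fun q => by
    obtain ⟨n, hn⟩ := exists_nat_ge q
    exact le_trans (by exact_mod_cast hn) (this n))

theorem ncard_points_inter_le (φ : CountingMeasure d) {B : Set (EuclideanSpace ℝ (Fin d))}
    (hb : Bornology.IsBounded B) : ((points φ ∩ B).ncard : ℝ) ≤ (φ.1 B).toReal := by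
  have hf := finite_points_inter φ hb
  have h : ((hf.toFinset.card : ℕ) : ENNReal) ≤ φ.1 B := card_le_measure (by simp)
  rw [Set.ncard_eq_toFinset_card _ hf]
  have := ENNReal.toReal_mono (measure_lt_top_of_isBounded φ hb).ne h
  simpa using this

/-- At a non-atom the measures of shrinking balls tend to `0`; being integers, they vanish for a
small ball. Thus `B` is locally null, hence null. -/
theorem measure_eq_zero_of_disjoint_points (φ : CountingMeasure d)
    {B : Set (EuclideanSpace ℝ (Fin d))} (h : Disjoint (points φ) B) : φ.1 B = 0 := by
  refine measure_null_of_locally_null B fun x hx => ?_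
  have h0 : φ.1 {x} = 0 := by
    by_contra hne
    exact Set.disjoint_left.1 h (show x ∈ points φ from hne) hx
  have hI : ⋂ n : ℕ, Metric.closedBall x (1 / ((n : ℝ) + 1)) = {x} := by
    refine Set.eq_singleton_iff_unique_mem.2 ⟨?_, fun y hy => ?_⟩
    · simp only [Set.mem_iInter]
      exact fun n => Metric.mem_closedBall_self (by positivity)
    · simp only [Set.mem_iInter, Metric.mem_closedBall] at hy
      exact dist_le_zero.1 (ge_of_tendsto' tendsto_one_div_add_atTop_nhds_zero_nat hy)
  have hlim := tendsto_measure_iInter_atTop (μ := φ.1)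
    (s := fun n : ℕ => Metric.closedBall x (1 / ((n : ℝ) + 1)))
    (fun n => Metric.isClosed_closedBall.measurableSet.nullMeasurableSet)
    (fun m n hmn => Metric.closedBall_subset_closedBall (by gcongr))
    ⟨0, (measure_lt_top_of_isBounded φ Metric.isBounded_closedBall).ne⟩
  rw [hI, h0] at hlim
  obtain ⟨n, hn⟩ := (hlim.eventually_lt_const zero_lt_one).exists
  obtain ⟨c, hc⟩ := φ.2 _ Metric.isClosed_closedBall.measurableSet
    (Metric.isBounded_closedBall (x := x) (r := 1 / ((n : ℝ) + 1)))
  refine ⟨_, mem_nhdsWithin_of_mem_nhds (Metric.closedBall_mem_nhds x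
    (ε := 1 / ((n : ℝ) + 1)) (by positivity)), ?_⟩
  rw [Function.comp_apply, hc] at hn
  rw [hc]
  have : c < 1 := by exact_mod_cast hn
  simp [Nat.lt_one_iff.1 this]

theorem measure_pos_iff_exists_point (φ : CountingMeasure d)
    {B : Set (EuclideanSpace ℝ (Fin d))} : 0 < φ.1 B ↔ (points φ ∩ B).Nonempty := by
  constructor
  · intro h
    by_contra hne
    rw [Set.not_nonempty_iff_eq_empty, ← Set.disjoint_iff_inter_eq_empty] at hne
    exact h.ne' (measure_eq_zero_of_disjoint_points φ hne)
  · rintro ⟨x, hx, hB⟩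
    exact (one_le_measure_singleton hx).trans_lt' zero_lt_one |>.trans_le
      (measure_mono (Set.singleton_subset_iff.2 hB))

theorem points_translate (a : EuclideanSpace ℝ (Fin d)) (φ : CountingMeasure d) :
    points (translate a φ) = (fun x => x + a) '' points φ := by
  ext x
  have h : (translate a φ).1 {x} = φ.1 {x - a} := by
    change φ.1.map (fun y => y + a) {x} = _
    rw [Measure.map_apply (measurable_add_const a) (measurableSet_singleton x)]
    congr 1
    ext y
    simp only [Set.mem_preimage, Set.mem_singleton_iff, eq_sub_iff_add_eq]
  constructor
  · intro hx
    refine ⟨x - a, ?_, by simp⟩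
    change φ.1 {x - a} ≠ 0
    rw [← h]
    exact hx
  · rintro ⟨y, hy, rfl⟩
    change (translate a φ).1 {y + a} ≠ 0
    rw [h, add_sub_cancel_right]
    exact hy

theorem translate_apply (a : EuclideanSpace ℝ (Fin d)) (φ : CountingMeasure d)
    {B : Set (EuclideanSpace ℝ (Fin d))} (hB : MeasurableSet B) :
    (translate a φ).1 B = φ.1 ((fun x => x + a) ⁻¹' B) :=
  Measure.map_apply (measurable_add_const a) hB

theorem translate_add (a b : EuclideanSpace ℝ (Fin d)) (φ : CountingMeasure d) :
    translate (a + b) φ = translate a (translate b φ) := by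
  apply Subtype.ext
  change φ.1.map _ = (φ.1.map _).map _
  rw [Measure.map_map (measurable_add_const a) (measurable_add_const b)]
  congr 1
  ext1 x
  simp [add_assoc, add_comm a b]

theorem translate_zero (φ : CountingMeasure d) : translate 0 φ = φ := by
  apply Subtype.ext
  change φ.1.map _ = φ.1
  simp

theorem measurable_apply {B : Set (EuclideanSpace ℝ (Fin d))} (hB : MeasurableSet B) :
    Measurable fun φ : CountingMeasure d => φ.1 B :=
  (Measure.measurable_coe hB).comp measurable_subtype_coe

theorem measurable_translate (a : EuclideanSpace ℝ (Fin d)) :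
    Measurable (translate a : CountingMeasure d → CountingMeasure d) :=
  ((Measure.measurable_map _ (measurable_add_const a)).comp measurable_subtype_coe).subtype_mk

end Points

/-! ### Measurability of functionals of the Čech complex -/

section Measurability

variable {d : ℕ}

/-- The index of the cube of side `1 / (m + 1)` containing `x`. -/
def gridIndex (m : ℕ) (x : EuclideanSpace ℝ (Fin d)) : Fin d → ℤ :=
  fun i => ⌊((m : ℝ) + 1) * x i⌋

/-- The lower corner of a cube of side `1 / (m + 1)`. -/
def gridCorner (m : ℕ) (z : Fin d → ℤ) : EuclideanSpace ℝ (Fin d) :=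
  WithLp.toLp 2 fun i => (z i : ℝ) / ((m : ℝ) + 1)

theorem measurable_gridIndex (m : ℕ) :
    Measurable (gridIndex m : EuclideanSpace ℝ (Fin d) → Fin d → ℤ) := by
  refine measurable_pi_lambda _ fun i => Int.measurable_floor.comp ?_
  have : Measurable fun x : EuclideanSpace ℝ (Fin d) => x i := by fun_prop
  exact this.const_mul _

theorem dist_gridCorner_gridIndex_le (m : ℕ) (x : EuclideanSpace ℝ (Fin d)) :
    dist (gridCorner m (gridIndex m x)) x ≤ √d * (1 / ((m : ℝ) + 1)) := by
  rw [EuclideanSpace.dist_eq]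
  have hm : (0 : ℝ) < (m : ℝ) + 1 := by positivity
  have h : ∀ i, dist ((gridCorner m (gridIndex m x)) i) (x i) ^ 2 ≤ (1 / ((m : ℝ) + 1)) ^ 2 := by
    intro i
    refine pow_le_pow_left₀ dist_nonneg ?_ 2
    change dist ((⌊((m : ℝ) + 1) * x i⌋ : ℝ) / ((m : ℝ) + 1)) (x i) ≤ _
    have h1 := Int.floor_le (((m : ℝ) + 1) * x i)
    have h2 := Int.lt_floor_add_one (((m : ℝ) + 1) * x i)
    rw [Real.dist_eq, abs_le]
    constructor
    · rw [← sub_nonneg]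
      have : (⌊((m : ℝ) + 1) * x i⌋ : ℝ) / ((m : ℝ) + 1) - x i - -(1 / ((m : ℝ) + 1)) =
        ((⌊((m : ℝ) + 1) * x i⌋ : ℝ) + 1 - ((m : ℝ) + 1) * x i) / ((m : ℝ) + 1) := by
        field_simp
        ring
      rw [this]
      exact div_nonneg (by linarith) hm.le
    · have : (⌊((m : ℝ) + 1) * x i⌋ : ℝ) / ((m : ℝ) + 1) ≤ x i := by
        rw [div_le_iff₀ hm]
        linarith
      have : 0 < 1 / ((m : ℝ) + 1) := by positivity
      linarith
  calc √(∑ i, dist ((gridCorner m (gridIndex m x)) i) (x i) ^ 2)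
      ≤ √(∑ _i : Fin d, (1 / ((m : ℝ) + 1)) ^ 2) := Real.sqrt_le_sqrt
        (Finset.sum_le_sum fun i _ => h i)
    _ = √d * (1 / ((m : ℝ) + 1)) := by
      rw [Finset.sum_const, Finset.card_univ, Fintype.card_fin, nsmul_eq_mul,
        Real.sqrt_mul (by positivity), Real.sqrt_sq (by positivity)]

/-- The indices of the cubes of side `1 / (m + 1)` that contain a point of `φ` in `B`. -/
def occupied {B : Set (EuclideanSpace ℝ (Fin d))} (hb : Bornology.IsBounded B) (m : ℕ)
    (φ : CountingMeasure d) : Finset (Fin d → ℤ) :=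
  ((finite_points_inter φ hb).image (gridIndex m)).toFinset

/-- A cube is occupied exactly when its part in `B` has positive `φ`-measure, and there are only
countably many finite index sets. The occupied set is thus a discrete random variable, to which any
`g` may be applied. -/
theorem measurable_comp_occupied {B : Set (EuclideanSpace ℝ (Fin d))} (hB : MeasurableSet B)
    (hb : Bornology.IsBounded B) (m : ℕ) (g : Finset (Fin d → ℤ) → ℝ) :
    Measurable fun φ : CountingMeasure d => g (occupied hb m φ) := by
  let _ : MeasurableSpace (Finset (Fin d → ℤ)) := ⊤
  have h : Measurable (occupied hb m : CountingMeasure d → Finset (Fin d → ℤ)) := by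
    refine measurable_to_countable' fun s => ?_
    have hs : (occupied hb m : CountingMeasure d → Finset (Fin d → ℤ)) ⁻¹' {s} =
        ⋂ z, {φ | 0 < φ.1 (B ∩ gridIndex m ⁻¹' {z}) ↔ z ∈ s} := by
      ext φ
      simp only [Set.mem_preimage, Set.mem_singleton_iff, Set.mem_iInter, Set.mem_ofPred_eq,
        Finset.ext_iff]
      refine forall_congr' fun z => ?_
      rw [measure_pos_iff_exists_point]
      have : z ∈ occupied hb m φ ↔ (points φ ∩ (B ∩ gridIndex m ⁻¹' {z})).Nonempty := by
        simp only [occupied, Set.Finite.mem_toFinset, Set.mem_image, Set.Nonempty, Set.mem_inter_iff,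
          Set.mem_preimage, Set.mem_singleton_iff, and_assoc]
      rw [this]
    rw [hs]
    refine MeasurableSet.iInter fun z => ?_
    have hm : MeasurableSet {φ : CountingMeasure d | 0 < φ.1 (B ∩ gridIndex m ⁻¹' {z})} :=
      measurableSet_lt measurable_const
        (measurable_apply (hB.inter (measurable_gridIndex m (measurableSet_singleton z))))
    by_cases hz : z ∈ s
    · simpa [hz] using hm
    · simp only [hz, iff_false]
      exact hm.compl
  exact (measurable_from_top (f := g)).comp h

-- Replace each point by the corner of its grid cube and enlarge the radius by the displacement
-- bound. The approximants depend only on the occupied cubes, and for each `φ` they eventually equal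
-- the true value by relabelling invariance.
open scoped Classical in
theorem measurable_cech_of_map
    {G : PreAbstractSimplicialComplex (EuclideanSpace ℝ (Fin d)) → ℕ}
    (hG : ∀ (f : EuclideanSpace ℝ (Fin d) → EuclideanSpace ℝ (Fin d))
      (K : PreAbstractSimplicialComplex (EuclideanSpace ℝ (Fin d))), K.faces.Finite →
      Set.InjOn f {x | ∃ σ ∈ K, x ∈ σ} → G (K.map f) = G K)
    {B : Set (EuclideanSpace ℝ (Fin d))} (hB : MeasurableSet B) (hb : Bornology.IsBounded B)
    (r : ℝ) : Measurable fun φ : CountingMeasure d => (G (cech (points φ ∩ B) r) : ℝ) := by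
  let δ : ℕ → ℝ := fun m => √d * (1 / ((m : ℝ) + 1))
  have hδ : Tendsto δ atTop (𝓝 0) := by
    have := (tendsto_one_div_add_atTop_nhds_zero_nat (𝕜 := ℝ)).const_mul (√d)
    rwa [mul_zero] at this
  refine measurable_of_tendsto_metrizable (f := fun (m : ℕ) (φ : CountingMeasure d) =>
    (G (cech (gridCorner m '' (occupied hb m φ : Set (Fin d → ℤ))) (r + δ m)) : ℝ))
    (fun m => measurable_comp_occupied hB hb m
      fun s => (G (cech (gridCorner m '' (s : Set (Fin d → ℤ))) (r + δ m)) : ℝ)) ?_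
  rw [tendsto_pi_nhds]
  intro φ
  have hf := finite_points_inter φ hb
  have h := eventually_map_cech hf r (p := fun m x => gridCorner m (gridIndex m x)) hδ
    dist_gridCorner_gridIndex_le
  refine tendsto_const_nhds.congr' ?_
  filter_upwards [h] with m hm
  have e : gridCorner m '' (occupied hb m φ : Set (Fin d → ℤ)) =
      (fun x => gridCorner m (gridIndex m x)) '' (points φ ∩ B) := by
    rw [occupied, Set.Finite.coe_toFinset, Set.image_image]
  rw [e, ← hm.2, hG _ _ (finite_faces_cech hf r) (injOn_vertices_cech hm.1)]

end Measurability

/-! ### Finite unions of vertex-disjoint complexes -/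

section UnionOfPieces

variable {V : Type*} {ι : Type*}

theorem mem_finset_sup {s : Finset ι} {f : ι → PreAbstractSimplicialComplex V} {σ : Finset V} :
    σ ∈ s.sup f ↔ ∃ i ∈ s, σ ∈ f i := by
  classical
  induction s using Finset.induction_on with
  | empty =>
    simp only [Finset.sup_empty, Finset.notMem_empty, false_and, exists_false, iff_false]
    exact fun h => h
  | insert a s _ ih =>
    rw [Finset.sup_insert]
    change σ ∈ (f a).faces ∪ (s.sup f).faces ↔ _
    rw [Set.mem_union]
    change σ ∈ f a ∨ σ ∈ s.sup f ↔ _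
    rw [ih]
    simp

theorem finite_faces_finset_sup {s : Finset ι} {f : ι → PreAbstractSimplicialComplex V}
    (h : ∀ i ∈ s, (f i).faces.Finite) : (s.sup f).faces.Finite := by
  refine (s.finite_toSet.biUnion h).subset fun σ hσ => ?_
  obtain ⟨i, hi, hσi⟩ := mem_finset_sup.1 (show σ ∈ s.sup f from hσ)
  exact Set.mem_biUnion hi hσi

variable {G : PreAbstractSimplicialComplex V → ℕ} {k : ℕ}

theorem IsAlmostAdditive.bot (hG : IsAlmostAdditive G k) : G ⊥ = 0 := by
  have hf : (⊥ : PreAbstractSimplicialComplex V).faces.Finite :=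
    Set.finite_empty.subset fun _ h => h
  have h := hG.sup ⊥ ⊥ hf hf fun σ hσ => hσ.elim
  rw [sup_idem] at h
  omega

theorem IsAlmostAdditive.finset_sup (hG : IsAlmostAdditive G k) {s : Finset ι}
    {f : ι → PreAbstractSimplicialComplex V} (hf : ∀ i ∈ s, (f i).faces.Finite)
    (hd : ∀ i ∈ s, ∀ j ∈ s, i ≠ j → VertexDisjoint (f i) (f j)) :
    G (s.sup f) = ∑ i ∈ s, G (f i) := by
  classical
  induction s using Finset.induction_on with
  | empty => simpa using hG.bot
  | insert a s ha ih =>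
    rw [Finset.sup_insert, Finset.sum_insert ha, ← ih (fun i hi => hf i (Finset.mem_insert_of_mem hi))
      fun i hi j hj => hd i (Finset.mem_insert_of_mem hi) j (Finset.mem_insert_of_mem hj)]
    refine hG.sup _ _ (hf a (Finset.mem_insert_self a s))
      (finite_faces_finset_sup fun i hi => hf i (Finset.mem_insert_of_mem hi)) ?_
    intro σ hσ τ hτ
    obtain ⟨j, hj, hτj⟩ := mem_finset_sup.1 hτ
    exact hd a (Finset.mem_insert_self a s) j (Finset.mem_insert_of_mem hj)
      (fun h => ha (h ▸ hj)) σ hσ τ hτj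

end UnionOfPieces

/-! ### Čech complexes over a family of pieces -/

section CechPieces

variable {E : Type*} [PseudoMetricSpace E] {ι : Type*}
  {G : PreAbstractSimplicialComplex E → ℕ} {k : ℕ}

theorem finset_sup_cech_le {X : Set E} {A : ι → Set E} {s : Finset ι} {B : Set E}
    (hAB : ∀ i ∈ s, A i ⊆ B) (r : ℝ) :
    (s.sup fun i => cech (X ∩ A i) r) ≤ cech (X ∩ B) r :=
  Finset.sup_le fun i hi => cech_mono (Set.inter_subset_inter_right X (hAB i hi)) r

theorem IsAlmostAdditive.finset_sup_cech (hG : IsAlmostAdditive G k) {X : Set E} {A : ι → Set E}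
    {s : Finset ι} (hA : ∀ i ∈ s, (X ∩ A i).Finite)
    (hd : ∀ i ∈ s, ∀ j ∈ s, i ≠ j → Disjoint (A i) (A j)) (r : ℝ) :
    G (s.sup fun i => cech (X ∩ A i) r) = ∑ i ∈ s, G (cech (X ∩ A i) r) := by
  refine hG.finset_sup (fun i hi => finite_faces_cech (hA i hi) r) ?_
  intro i hi j hj hij σ hσ τ hτ
  rw [Finset.disjoint_left]
  intro x hx hx'
  exact Set.disjoint_left.1 (hd i hi j hj hij) ((mem_cech.1 hσ).2.1 hx).2
    ((mem_cech.1 hτ).2.1 hx').2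

/-- Superadditivity: the pieces form a vertex-disjoint subcomplex of the whole. -/
theorem IsAlmostAdditive.sum_cech_le (hG : IsAlmostAdditive G k) {X : Set E} {A : ι → Set E}
    {s : Finset ι} {B : Set E} (hB : (X ∩ B).Finite) (hAB : ∀ i ∈ s, A i ⊆ B)
    (hd : ∀ i ∈ s, ∀ j ∈ s, i ≠ j → Disjoint (A i) (A j)) (r : ℝ) :
    ∑ i ∈ s, G (cech (X ∩ A i) r) ≤ G (cech (X ∩ B) r) := by
  rw [← hG.finset_sup_cech
    (fun i hi => hB.subset (Set.inter_subset_inter_right X (hAB i hi))) hd r]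
  exact hG.mono _ _ (finite_faces_cech hB r) (finset_sup_cech_le hAB r)

/-- A simplex that lies in no complex of a family of pieces has vertices outside every piece. -/
theorem exists_notMem_of_notMem_sup {X : Set E} {A : ι → Set E} {s : Finset ι} {B : Set E} {r : ℝ}
    {n : ℕ} {v : Fin n → E} (hv : v ∈ orderedSimplices (cech (X ∩ B) r) n)
    (hv' : v ∉ orderedSimplices (s.sup fun i => cech (X ∩ A i) r) n) {i : ι} (hi : i ∈ s) :
    ∃ j, v j ∉ A i := by
  by_contra! h
  refine hv' ⟨hv.1, ?_⟩
  obtain ⟨-, σ, hσ, e⟩ := hv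
  obtain ⟨hne, hs, hy⟩ := mem_cech.1 hσ
  refine ⟨σ, mem_finset_sup.2 ⟨i, hi, mem_cech.2 ⟨hne, fun x hx => ⟨(hs hx).1, ?_⟩, hy⟩⟩, e⟩
  obtain ⟨j, rfl⟩ := e ▸ hx
  exact h j

theorem ncard_orderedSimplices_cech_le {X : Set E} (hX : X.Finite) (r : ℝ) (n : ℕ) :
    (orderedSimplices (cech X r) n).ncard ≤ X.ncard ^ n := by
  classical
  have hsub : orderedSimplices (cech X r) n ⊆
      ((Fintype.piFinset fun _ => hX.toFinset : Finset (Fin n → E)) : Set (Fin n → E)) := by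
    intro v hv
    rw [Finset.mem_coe, Fintype.mem_piFinset]
    exact fun i => hX.mem_toFinset.2 (mem_of_mem_orderedSimplices hv i)
  refine (Set.ncard_le_ncard hsub (Finset.finite_toSet _)).trans_eq ?_
  rw [Set.ncard_coe_finset, Fintype.card_piFinset_const, ← Set.ncard_eq_toFinset_card _ hX]

theorem IsAlmostAdditive.cech_le (hG : IsAlmostAdditive G k) {X : Set E} (hX : X.Finite) (r : ℝ) :
    G (cech X r) ≤ 2 * (X.ncard ^ (k + 1) + X.ncard ^ (k + 2)) := by
  have hK := finite_faces_cech hX r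
  have h := hG.le_add (cech X r) ⊥ hK bot_le
  rw [hG.bot, zero_add] at h
  have h1 : ∀ n, (orderedSimplices (cech X r) n \
      orderedSimplices (⊥ : PreAbstractSimplicialComplex E) n).ncard ≤ X.ncard ^ n := fun n =>
    (Set.ncard_le_ncard Set.sdiff_subset (finite_orderedSimplices hK n)).trans
      (ncard_orderedSimplices_cech_le hX r n)
  have h2 := h1 (k + 1)
  have h3 := h1 (k + 2)
  omega

end CechPieces

/-! ### Tilings by cubes and the error from crossing simplices -/

section Cells

variable {d : ℕ}

/-- The half-open cube with lower corner `a` and side `s`. -/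
def cell (a : EuclideanSpace ℝ (Fin d)) (s : ℝ) : Set (EuclideanSpace ℝ (Fin d)) :=
  {x | ∀ i, x i ∈ Set.Ico (a i) (a i + s)}

/-- The lattice point with integer coordinates `z`. -/
def latticePoint (z : Fin d → ℤ) : EuclideanSpace ℝ (Fin d) :=
  WithLp.toLp 2 fun i => (z i : ℝ)

@[simp]
theorem latticePoint_apply (z : Fin d → ℤ) (i : Fin d) : latticePoint z i = z i := rfl

theorem latticePoint_add (y z : Fin d → ℤ) :
    latticePoint (y + z) = latticePoint y + latticePoint z := by
  ext i
  simp

/-- The point all of whose coordinates are equal to `c`. -/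
def diagonalPoint (d : ℕ) (c : ℝ) : EuclideanSpace ℝ (Fin d) :=
  WithLp.toLp 2 fun _ => c

@[simp]
theorem diagonalPoint_apply (c : ℝ) (i : Fin d) : diagonalPoint d c i = c := rfl

theorem window_eq_cell (d : ℕ) (l : ℝ) : window d l = cell (diagonalPoint d (-(l / 2))) l := by
  ext x
  refine forall_congr' fun i => ?_
  rw [diagonalPoint_apply, show -(l / 2) + l = l / 2 by ring]

theorem measurableSet_cell (a : EuclideanSpace ℝ (Fin d)) (s : ℝ) : MeasurableSet (cell a s) := by
  have : cell a s = ⋂ i, (fun x : EuclideanSpace ℝ (Fin d) => x i) ⁻¹' Set.Ico (a i) (a i + s) := by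
    ext x
    simp [cell]
  rw [this]
  refine MeasurableSet.iInter fun i => ?_
  have h : Measurable fun x : EuclideanSpace ℝ (Fin d) => x i := by fun_prop
  exact h measurableSet_Ico

theorem isBounded_cell (a : EuclideanSpace ℝ (Fin d)) (s : ℝ) :
    Bornology.IsBounded (cell a s) := by
  have h : Bornology.IsBounded (Set.pi Set.univ fun i => Set.Icc (a i) (a i + s)) :=
    Bornology.IsBounded.pi fun i => Metric.isBounded_Icc _ _
  refine ((PiLp.antilipschitzWith_ofLp 2 fun _ : Fin d => ℝ).isBounded_preimage h).subset ?_
  intro x hx i _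
  exact ⟨(hx i).1, (hx i).2.le⟩

theorem preimage_add_cell (a b : EuclideanSpace ℝ (Fin d)) (s : ℝ) :
    (fun x => x + -a) ⁻¹' cell b s = cell (a + b) s := by
  ext x
  refine forall_congr' fun i => ?_
  simp only [PiLp.add_apply, PiLp.neg_apply, Set.mem_Ico]
  constructor <;> rintro ⟨h1, h2⟩ <;> constructor <;> linarith

theorem points_translate_inter_cell (a b : EuclideanSpace ℝ (Fin d)) (s : ℝ)
    (φ : CountingMeasure d) : points (translate (-a) φ) ∩ cell b s =
      (fun x => x + -a) '' (points φ ∩ cell (a + b) s) := by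
  rw [points_translate, ← preimage_add_cell, Set.image_inter_preimage]

theorem IsAlmostAdditive.cech_translate {k : ℕ}
    {G : PreAbstractSimplicialComplex (EuclideanSpace ℝ (Fin d)) → ℕ} (hG : IsAlmostAdditive G k)
    (r : ℝ) (a b : EuclideanSpace ℝ (Fin d)) (s : ℝ) (φ : CountingMeasure d) :
    G (cech (points (translate (-a) φ) ∩ cell b s) r) = G (cech (points φ ∩ cell (a + b) s) r) := by
  classical
  rw [points_translate_inter_cell]
  have h := map_cech_of_isometryEquiv (points φ ∩ cell (a + b) s) r (IsometryEquiv.addRight (-a))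
  have h' := hG.map (IsometryEquiv.addRight (-a)) (cech (points φ ∩ cell (a + b) s) r)
    (finite_faces_cech (finite_points_inter φ (isBounded_cell _ _)) r)
    (IsometryEquiv.addRight (-a)).injective.injOn
  rw [h] at h'
  exact h'

theorem measure_translate_cell (a b : EuclideanSpace ℝ (Fin d)) (s : ℝ) (φ : CountingMeasure d) :
    (translate (-a) φ).1 (cell b s) = φ.1 (cell (a + b) s) := by
  rw [translate_apply _ _ (measurableSet_cell b s), preimage_add_cell]

/-- The cube of side `m` with index `z` of the tiling of `ℝ^d` with origin `a`. -/
def tile (a : EuclideanSpace ℝ (Fin d)) (m : ℕ) (z : Fin d → ℤ) :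
    Set (EuclideanSpace ℝ (Fin d)) :=
  cell (a + (m : ℝ) • latticePoint z) m

theorem mem_tile {a : EuclideanSpace ℝ (Fin d)} {m : ℕ} (hm : 0 < m) {z : Fin d → ℤ}
    {x : EuclideanSpace ℝ (Fin d)} : x ∈ tile a m z ↔ ∀ i, ⌊(x i - a i) / m⌋ = z i := by
  refine forall_congr' fun i => ?_
  have hm' : (0 : ℝ) < m := by exact_mod_cast hm
  rw [Int.floor_eq_iff, le_div_iff₀ hm', div_lt_iff₀ hm']
  simp only [PiLp.add_apply, PiLp.smul_apply, latticePoint_apply, smul_eq_mul, Set.mem_Ico]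
  constructor <;> rintro ⟨h1, h2⟩ <;> constructor <;> linarith

theorem disjoint_tile (a : EuclideanSpace ℝ (Fin d)) {m : ℕ} (hm : 0 < m) {y z : Fin d → ℤ}
    (h : y ≠ z) : Disjoint (tile a m y) (tile a m z) := by
  rw [Set.disjoint_left]
  intro x hy hz
  rw [mem_tile hm] at hy hz
  exact h (funext fun i => (hy i).symm.trans (hz i))

/-- The indices of the unit cells of the cube of side `m` at distance less than `ρ` from the
complement of the cube. -/
def boundaryCells (d m ρ : ℕ) : Finset (Fin d → ℤ) :=
  Finset.Icc (fun _ => 0) (fun _ => (m : ℤ) - 1) \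
    Finset.Icc (fun _ => (ρ : ℤ)) (fun _ => (m : ℤ) - 1 - ρ)

theorem card_boundaryCells {m ρ : ℕ} (h : 2 * ρ ≤ m) :
    (boundaryCells d m ρ).card = m ^ d - (m - 2 * ρ) ^ d := by
  have hsub : Finset.Icc (fun _ : Fin d => (ρ : ℤ)) (fun _ => (m : ℤ) - 1 - ρ) ⊆
      Finset.Icc (fun _ => 0) (fun _ => (m : ℤ) - 1) :=
    Finset.Icc_subset_Icc (fun _ => by simp) (fun _ => by simp only; omega)
  rw [boundaryCells, Finset.card_sdiff_of_subset hsub, Pi.card_Icc, Pi.card_Icc]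
  simp only [Int.card_Icc, Finset.prod_const, Finset.card_univ, Fintype.card_fin]
  congr 2
  · omega
  · omega

/-- The sum, over the boundary cells of the cube of side `m`, of the `n`-th powers of the numbers of
points of `φ` within distance `ρ` of the cell. -/
def boundaryCount (m ρ n : ℕ) (φ : CountingMeasure d) : ℝ :=
  ∑ u ∈ boundaryCells d m ρ,
    (φ.1 (cell (latticePoint u - diagonalPoint d ρ) (1 + 2 * ρ))).toReal ^ n

theorem boundaryCount_translate (m ρ n : ℕ) (a : EuclideanSpace ℝ (Fin d))
    (φ : CountingMeasure d) : boundaryCount m ρ n (translate (-a) φ) =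
      ∑ u ∈ boundaryCells d m ρ,
        (φ.1 (cell (a + (latticePoint u - diagonalPoint d ρ)) (1 + 2 * ρ))).toReal ^ n := by
  simp only [boundaryCount, measure_translate_cell]

theorem abs_apply_sub_le_dist (x y : EuclideanSpace ℝ (Fin d)) (i : Fin d) :
    |x i - y i| ≤ dist x y := by
  rw [dist_eq_norm, ← Real.norm_eq_abs]
  exact PiLp.norm_apply_le (x - y) i

theorem exists_boundaryCell {a : EuclideanSpace ℝ (Fin d)} {m ρ : ℕ} {n : ℕ}
    {v : Fin (n + 1) → EuclideanSpace ℝ (Fin d)} (hv : ∀ i j, dist (v i) (v j) ≤ ρ)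
    (h0 : v 0 ∈ cell a m) (h : ∃ j, v j ∉ cell a m) :
    ∃ u ∈ boundaryCells d m ρ, ∀ i, v i ∈
      cell (a + (latticePoint u - diagonalPoint d ρ)) (1 + 2 * ρ) := by
  -- The unit cell of the first vertex, relative to `a`. All vertices lie within `ρ` of it
  -- coordinatewise, so an inner cell would keep the whole tuple in the cube.
  let u : Fin d → ℤ := fun i => ⌊v 0 i - a i⌋
  have hu1 : ∀ i, (u i : ℝ) ≤ v 0 i - a i := fun i => Int.floor_le _
  have hu2 : ∀ i, v 0 i - a i < u i + 1 := fun i => Int.lt_floor_add_one _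
  have hvj : ∀ j i, a i + u i - ρ ≤ v j i ∧ v j i < a i + u i + 1 + ρ := by
    intro j i
    have h1 := (abs_apply_sub_le_dist (v j) (v 0) i).trans (hv j 0)
    rw [abs_le] at h1
    have h2 := hu1 i
    have h3 := hu2 i
    constructor <;> linarith
  refine ⟨u, ?_, fun j i => ?_⟩
  · rw [boundaryCells, Finset.mem_sdiff, Finset.mem_Icc, Finset.mem_Icc]
    refine ⟨⟨fun i => Int.floor_nonneg.2 (by linarith [(h0 i).1]), fun i => ?_⟩, fun hin => ?_⟩
    · have : u i < (m : ℤ) := Int.floor_lt.2 (by push_cast; linarith [(h0 i).2])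
      exact Int.le_sub_one_of_lt this
    · obtain ⟨j, hj⟩ := h
      refine hj fun i => ?_
      obtain ⟨h1, h2⟩ := hvj j i
      have h3 : ((ρ : ℤ) : ℝ) ≤ u i := by exact_mod_cast hin.1 i
      have h4 : (u i : ℝ) ≤ ((m : ℤ) - 1 - (ρ : ℤ) : ℤ) := by exact_mod_cast hin.2 i
      push_cast at h3 h4
      constructor <;> linarith
  · obtain ⟨h1, h2⟩ := hvj j i
    simp only [PiLp.add_apply, PiLp.sub_apply, latticePoint_apply, diagonalPoint_apply,
      Set.mem_Ico]
    constructor <;> linarith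

/-- Charge a crossing tuple to the tile of its first vertex and to the boundary cell found there:
the enlarged cell contains all `n + 1` vertices, so a power of its point count bounds such tuples.
-/
theorem ncard_crossing_le (φ : CountingMeasure d) (a : EuclideanSpace ℝ (Fin d)) (m : ℕ) {ρ : ℕ}
    {r : ℝ} (hρ : 2 * r ≤ ρ) (s : Finset (Fin d → ℤ)) (n : ℕ) :
    ((orderedSimplices (cech (points φ ∩ ⋃ z ∈ s, tile a m z) r) (n + 1) \
      orderedSimplices (s.sup fun z => cech (points φ ∩ tile a m z) r) (n + 1)).ncard : ℝ) ≤
    ∑ z ∈ s, boundaryCount m ρ (n + 1) (translate (-(a + (m : ℝ) • latticePoint z)) φ) := by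
  classical
  let C : (Fin d → ℤ) → (Fin d → ℤ) → Set (EuclideanSpace ℝ (Fin d)) := fun z u =>
    cell (a + (m : ℝ) • latticePoint z + (latticePoint u - diagonalPoint d ρ)) (1 + 2 * ρ)
  have hC : ∀ z u, (points φ ∩ C z u).Finite :=
    fun z u => finite_points_inter φ (isBounded_cell _ _)
  let T : Finset (Fin (n + 1) → EuclideanSpace ℝ (Fin d)) :=
    s.biUnion fun z => (boundaryCells d m ρ).biUnion fun u =>
      Fintype.piFinset fun _ => (hC z u).toFinset
  have hsub : orderedSimplices (cech (points φ ∩ ⋃ z ∈ s, tile a m z) r) (n + 1) \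
      orderedSimplices (s.sup fun z => cech (points φ ∩ tile a m z) r) (n + 1) ⊆
      (T : Set (Fin (n + 1) → EuclideanSpace ℝ (Fin d))) := by
    rintro v ⟨hv, hv'⟩
    have h0 := (mem_of_mem_orderedSimplices hv 0).2
    simp only [Set.mem_iUnion] at h0
    obtain ⟨z, hz, h0⟩ := h0
    obtain ⟨u, hu, huv⟩ := exists_boundaryCell
      (fun i j => (dist_le_of_mem_orderedSimplices hv i j).trans hρ) h0
      (exists_notMem_of_notMem_sup hv hv' hz)
    simp only [T, Finset.mem_coe, Finset.mem_biUnion, Fintype.mem_piFinset,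
      Set.Finite.mem_toFinset]
    exact ⟨z, hz, u, hu, fun i => ⟨(mem_of_mem_orderedSimplices hv i).1, huv i⟩⟩
  have h1 : (orderedSimplices (cech (points φ ∩ ⋃ z ∈ s, tile a m z) r) (n + 1) \
      orderedSimplices (s.sup fun z => cech (points φ ∩ tile a m z) r) (n + 1)).ncard ≤ T.card := by
    rw [← Set.ncard_coe_finset T]
    exact Set.ncard_le_ncard hsub T.finite_toSet
  have h2 : T.card ≤ ∑ z ∈ s, ∑ u ∈ boundaryCells d m ρ, (points φ ∩ C z u).ncard ^ (n + 1) := by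
    refine Finset.card_biUnion_le.trans (Finset.sum_le_sum fun z _ => ?_)
    refine Finset.card_biUnion_le.trans (Finset.sum_le_sum fun u _ => ?_)
    rw [Fintype.card_piFinset_const, ← Set.ncard_eq_toFinset_card _ (hC z u)]
  refine (Nat.cast_le.2 (h1.trans h2)).trans ?_
  push_cast
  refine Finset.sum_le_sum fun z _ => ?_
  rw [boundaryCount_translate]
  refine Finset.sum_le_sum fun u _ => ?_
  exact pow_le_pow_left₀ (by positivity) (ncard_points_inter_le φ (isBounded_cell _ _)) _

/-- The bound for the failure of additivity of a functional along the tiles of side `m`. -/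
def tileError (m ρ k : ℕ) (φ : CountingMeasure d) : ℝ :=
  2 * (boundaryCount m ρ (k + 1) φ + boundaryCount m ρ (k + 2) φ)

/-- Monotonicity passes from `B` to the covering tiles; separating these tiles costs at most the
tuples that cross between them. -/
theorem IsAlmostAdditive.le_sum_tile {k : ℕ}
    {G : PreAbstractSimplicialComplex (EuclideanSpace ℝ (Fin d)) → ℕ} (hG : IsAlmostAdditive G k)
    (φ : CountingMeasure d) (a : EuclideanSpace ℝ (Fin d)) {m : ℕ} (hm : 0 < m) {ρ : ℕ}
    {r : ℝ} (hρ : 2 * r ≤ ρ) (s : Finset (Fin d → ℤ)) {B : Set (EuclideanSpace ℝ (Fin d))}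
    (hB : B ⊆ ⋃ z ∈ s, tile a m z) :
    (G (cech (points φ ∩ B) r) : ℝ) ≤
      ∑ z ∈ s, ((G (cech (points (translate (-(a + (m : ℝ) • latticePoint z)) φ) ∩ cell 0 m) r) : ℝ) +
        tileError m ρ k (translate (-(a + (m : ℝ) • latticePoint z)) φ)) := by
  have hbd : Bornology.IsBounded (⋃ z ∈ s, tile a m z) :=
    (Bornology.isBounded_biUnion_finset s).2 fun z _ => isBounded_cell _ _
  have hfin := finite_faces_cech (finite_points_inter φ hbd) r
  have h1 := hG.mono _ _ hfin (cech_mono (Set.inter_subset_inter_right (points φ) hB) r)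
  have h2 := hG.le_add _ _ hfin (finset_sup_cech_le (X := points φ) (s := s) (A := tile a m)
    (fun z hz => Set.subset_biUnion_of_mem (u := tile a m) hz) r)
  rw [hG.finset_sup_cech (A := tile a m)
    (fun z _ => finite_points_inter φ (isBounded_cell _ _)) (fun y _ z _ h => disjoint_tile a hm h)] at h2
  have h3 := ncard_crossing_le φ a m hρ s k
  have h4 := ncard_crossing_le φ a m hρ s (k + 1)
  have h5 : (G (cech (points φ ∩ B) r) : ℝ) ≤ _ := Nat.cast_le.2 (h1.trans h2)
  push_cast at h5
  have e : ∀ z, G (cech (points (translate (-(a + (m : ℝ) • latticePoint z)) φ) ∩ cell 0 m) r) =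
      G (cech (points φ ∩ tile a m z) r) := by
    intro z
    rw [hG.cech_translate, add_zero]
    rfl
  simp only [e, tileError, Finset.sum_add_distrib, ← Finset.mul_sum]
  linarith

theorem IsAlmostAdditive.sum_tile_le {k : ℕ}
    {G : PreAbstractSimplicialComplex (EuclideanSpace ℝ (Fin d)) → ℕ} (hG : IsAlmostAdditive G k)
    (φ : CountingMeasure d) (a : EuclideanSpace ℝ (Fin d)) {m : ℕ} (hm : 0 < m)
    (r : ℝ) (s : Finset (Fin d → ℤ)) {B : Set (EuclideanSpace ℝ (Fin d))}
    (hb : Bornology.IsBounded B) (hB : ∀ z ∈ s, tile a m z ⊆ B) :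
    ∑ z ∈ s, (G (cech (points (translate (-(a + (m : ℝ) • latticePoint z)) φ) ∩ cell 0 m) r) : ℝ) ≤
      G (cech (points φ ∩ B) r) := by
  have e : ∀ z, G (cech (points (translate (-(a + (m : ℝ) • latticePoint z)) φ) ∩ cell 0 m) r) =
      G (cech (points φ ∩ tile a m z) r) := by
    intro z
    rw [hG.cech_translate, add_zero]
    rfl
  simp only [e]
  exact_mod_cast hG.sum_cech_le (finite_points_inter φ hb) hB (fun y _ z _ h => disjoint_tile a hm h) r

end Cells

/-! ### A covering lemma and the maximal inequality for `ℤ^d`-actions -/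

section Maximal

open scoped ENNReal

variable {d : ℕ}

/-- The cube of lattice points at sup-distance at most `n` from `z`. -/
def box (z : Fin d → ℤ) (n : ℕ) : Finset (Fin d → ℤ) :=
  Finset.Icc (fun i => z i - n) (fun i => z i + n)

theorem mem_box {z y : Fin d → ℤ} {n : ℕ} : y ∈ box z n ↔ ∀ i, z i - n ≤ y i ∧ y i ≤ z i + n := by
  rw [box, Finset.mem_Icc, Pi.le_def, Pi.le_def, forall_and]

theorem card_box (z : Fin d → ℤ) (n : ℕ) : (box z n).card = (2 * n + 1) ^ d := by
  rw [box, Pi.card_Icc]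
  simp only [Int.card_Icc]
  rw [Finset.prod_congr rfl (g := fun _ => 2 * n + 1) fun i _ => by omega]
  simp

theorem mem_box_of_not_disjoint {y z : Fin d → ℤ} {m n : ℕ} (hmn : m ≤ n)
    (h : ¬ Disjoint (box y m) (box z n)) : y ∈ box z (2 * n) := by
  obtain ⟨x, hx, hx'⟩ := Finset.not_disjoint_iff.1 h
  rw [mem_box] at hx hx' ⊢
  intro i
  have h1 := hx i
  have h2 := hx' i
  push_cast
  omega

/-- Greedy selection: take a box of largest radius. Boxes meeting it have their centres in the box
of twice the radius, which has at most `2 ^ d` times as many points, so the weight of the chosen box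
pays for all these centres. `D` holds the weight still unspent; the chosen box is removed from it.
-/
theorem vitali_box (w : (Fin d → ℤ) → ℝ≥0∞) (c : ℝ≥0∞) (n : (Fin d → ℤ) → ℕ) :
    ∀ B D : Finset (Fin d → ℤ), (∀ z ∈ B, box z (n z) ⊆ D ∧
      c * ((2 * n z + 1 : ℕ) : ℝ≥0∞) ^ d ≤ ∑ y ∈ box z (n z), w y) →
    c * B.card ≤ 2 ^ d * ∑ y ∈ D, w y := by
  classical
  intro B
  induction B using Finset.strongInduction with
  | H B ih =>
    intro D hB
    obtain rfl | hne := B.eq_empty_or_nonempty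
    · simp
    obtain ⟨z, hz, hmax⟩ := B.exists_max_image n hne
    let B' := B.filter fun y => Disjoint (box y (n y)) (box z (n z))
    have hzB' : z ∉ B' := by
      intro h
      have := (Finset.mem_filter.1 h).2
      rw [disjoint_self] at this
      have hc := card_box z (n z)
      rw [this] at hc
      exact absurd hc.symm (by simp)
    have hss : B' ⊂ B := Finset.filter_ssubset.2
      ⟨z, hz, fun h => hzB' (Finset.mem_filter.2 ⟨hz, h⟩)⟩
    have h1 := ih B' hss (D \ box z (n z)) fun y hy => by
      obtain ⟨hy, hd⟩ := Finset.mem_filter.1 hy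
      exact ⟨Finset.subset_sdiff.2 ⟨(hB y hy).1, hd⟩, (hB y hy).2⟩
    have h2 : B.card ≤ B'.card + (4 * n z + 1) ^ d := by
      have hcov : B ⊆ B' ∪ box z (2 * n z) := by
        intro y hy
        by_cases hd : Disjoint (box y (n y)) (box z (n z))
        · exact Finset.mem_union_left _ (Finset.mem_filter.2 ⟨hy, hd⟩)
        · exact Finset.mem_union_right _ (mem_box_of_not_disjoint (hmax y hy) hd)
      refine (Finset.card_le_card hcov).trans ((Finset.card_union_le _ _).trans_eq ?_)
      rw [card_box]
      ring_nf
    have h3 : (4 * n z + 1) ^ d ≤ 2 ^ d * (2 * n z + 1) ^ d := by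
      rw [← mul_pow]
      exact Nat.pow_le_pow_left (by omega) d
    calc c * B.card ≤ c * ((B'.card + 2 ^ d * (2 * n z + 1) ^ d : ℕ) : ℝ≥0∞) := by
          gcongr
          exact h2.trans (Nat.add_le_add_left h3 _)
      _ = c * B'.card + 2 ^ d * (c * ((2 * n z + 1 : ℕ) : ℝ≥0∞) ^ d) := by
          push_cast
          ring
      _ ≤ 2 ^ d * ∑ y ∈ D \ box z (n z), w y + 2 ^ d * ∑ y ∈ box z (n z), w y := by
          gcongr
          exact (hB z hz).2
      _ = 2 ^ d * ∑ y ∈ D, w y := by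
          rw [← mul_add, Finset.sum_sdiff (hB z hz).1]

variable {X : Type*} [MeasurableSpace X] {μ : Measure X}

/-- The weak-type maximal inequality for averages over cubes under an action of `ℤ^d`. -/
theorem measure_maximal_le {S : (Fin d → ℤ) → X → X} (hS : ∀ z, MeasurePreserving (S z) μ μ)
    (hadd : ∀ y z x, S (y + z) x = S y (S z x)) {v : X → ℝ≥0∞} (hv : Measurable v) (c : ℝ≥0∞) :
    c * μ {x | ∃ n : ℕ, c * ((2 * n + 1 : ℕ) : ℝ≥0∞) ^ d ≤ ∑ y ∈ box 0 n, v (S y x)} ≤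
      4 ^ d * ∫⁻ x, v x ∂μ := by
  classical
  -- Truncating the radii at `N` keeps the boxes about points of `box 0 N` inside `box 0 (N + N)`.
  let A : ℕ → Set X := fun N =>
    {x | ∃ n ≤ N, c * ((2 * n + 1 : ℕ) : ℝ≥0∞) ^ d ≤ ∑ y ∈ box 0 n, v (S y x)}
  have hAm : ∀ N, MeasurableSet (A N) := by
    intro N
    have : A N = ⋃ n ∈ Set.Iic N,
        {x | c * ((2 * n + 1 : ℕ) : ℝ≥0∞) ^ d ≤ ∑ y ∈ box 0 n, v (S y x)} := by
      ext x
      simp [A]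
    rw [this]
    refine MeasurableSet.biUnion (Set.to_countable _) fun n _ => ?_
    exact measurableSet_le measurable_const
      (Finset.measurable_fun_sum _ fun y _ => hv.comp (hS y).measurable)
  -- Transference: the covering lemma is applied along the orbit of a single `x`, then integrated.
  have hpt : ∀ N x, c * ((box 0 N).filter fun z => S z x ∈ A N).card ≤
      2 ^ d * ∑ y ∈ box 0 (N + N), v (S y x) := by
    intro N x
    have : ∀ z, ∃ n, S z x ∈ A N → n ≤ N ∧
        c * ((2 * n + 1 : ℕ) : ℝ≥0∞) ^ d ≤ ∑ y ∈ box 0 n, v (S y (S z x)) := by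
      intro z
      by_cases h : S z x ∈ A N
      · obtain ⟨n, hn⟩ := h
        exact ⟨n, fun _ => hn⟩
      · exact ⟨0, fun h' => absurd h' h⟩
    choose n hn using this
    refine vitali_box (fun y => v (S y x)) c n _ _ fun z hz => ?_
    obtain ⟨hz, hzA⟩ := Finset.mem_filter.1 hz
    obtain ⟨h1, h2⟩ := hn z hzA
    refine ⟨fun y hy => ?_, h2.trans_eq ?_⟩
    · rw [mem_box] at hy hz ⊢
      intro i
      have h3 := hy i
      have h4 := hz i
      simp only [Pi.zero_apply] at h4 ⊢
      push_cast
      omega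
    · refine Finset.sum_nbij' (fun y => y + z) (fun y => y - z) ?_ ?_ ?_ ?_ ?_
      · intro y hy
        rw [mem_box] at hy ⊢
        intro i
        have := hy i
        simp only [Pi.zero_apply, Pi.add_apply] at this ⊢
        omega
      · intro y hy
        rw [mem_box] at hy ⊢
        intro i
        have := hy i
        simp only [Pi.zero_apply, Pi.sub_apply] at this ⊢
        omega
      · intro y _
        simp
      · intro y _
        simp
      · intro y _
        rw [hadd]
  have hN : ∀ N, c * μ (A N) ≤ 4 ^ d * ∫⁻ x, v x ∂μ := by
    intro N
    have h1 : ∑ z ∈ box (0 : Fin d → ℤ) N, μ (S z ⁻¹' A N) =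
        ((2 * N + 1 : ℕ) : ℝ≥0∞) ^ d * μ (A N) := by
      rw [Finset.sum_congr rfl fun z _ =>
        (hS z).measure_preimage (hAm N).nullMeasurableSet, Finset.sum_const, card_box,
        nsmul_eq_mul]
      push_cast
      rfl
    have h2 : c * ∑ z ∈ box (0 : Fin d → ℤ) N, μ (S z ⁻¹' A N) ≤
        2 ^ d * (((2 * (N + N) + 1 : ℕ) : ℝ≥0∞) ^ d * ∫⁻ x, v x ∂μ) := by
      have hmeas : ∀ z, Measurable fun x => (S z ⁻¹' A N).indicator (1 : X → ℝ≥0∞) x := fun z =>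
        measurable_one.indicator ((hS z).measurable (hAm N))
      calc c * ∑ z ∈ box (0 : Fin d → ℤ) N, μ (S z ⁻¹' A N)
          = ∫⁻ x, c * ∑ z ∈ box (0 : Fin d → ℤ) N,
              (S z ⁻¹' A N).indicator (1 : X → ℝ≥0∞) x ∂μ := by
            rw [lintegral_const_mul _ (Finset.measurable_fun_sum _ fun z _ => hmeas z),
              lintegral_finsetSum _ fun z _ => hmeas z]
            congr 1
            refine Finset.sum_congr rfl fun z _ => ?_
            rw [lintegral_indicator_one ((hS z).measurable (hAm N))]
        _ ≤ ∫⁻ x, 2 ^ d * ∑ y ∈ box 0 (N + N), v (S y x) ∂μ := by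
            refine lintegral_mono fun x => (le_of_eq ?_).trans (hpt N x)
            congr 1
            rw [Finset.card_filter]
            push_cast
            refine Finset.sum_congr rfl fun z _ => ?_
            by_cases h : S z x ∈ A N
            · simp [h]
            · simp [h]
        _ = 2 ^ d * (((2 * (N + N) + 1 : ℕ) : ℝ≥0∞) ^ d * ∫⁻ x, v x ∂μ) := by
            have hm : ∀ y, Measurable fun x => v (S y x) := fun y => hv.comp (hS y).measurable
            rw [lintegral_const_mul _ (Finset.measurable_fun_sum _ fun y _ => hm y),
              lintegral_finsetSum _ fun y _ => hm y,
              Finset.sum_congr rfl fun y _ => (hS y).lintegral_comp hv, Finset.sum_const, card_box,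
              nsmul_eq_mul]
            push_cast
            rfl
    rw [h1] at h2
    -- Doubling the box costs a second factor `2 ^ d`; with the covering constant this makes `4 ^
    -- d`.
    have h3 : ((2 * (N + N) + 1 : ℕ) : ℝ≥0∞) ^ d ≤ 2 ^ d * ((2 * N + 1 : ℕ) : ℝ≥0∞) ^ d := by
      rw [← mul_pow]
      refine pow_le_pow_left' ?_ d
      exact_mod_cast (by omega : 2 * (N + N) + 1 ≤ 2 * (2 * N + 1))
    have h0 : ((2 * N + 1 : ℕ) : ℝ≥0∞) ^ d ≠ 0 := pow_ne_zero _ (by simp)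
    have ht : ((2 * N + 1 : ℕ) : ℝ≥0∞) ^ d ≠ ⊤ := ENNReal.pow_ne_top (ENNReal.natCast_ne_top _)
    rw [← ENNReal.mul_le_mul_iff_right h0 ht]
    calc ((2 * N + 1 : ℕ) : ℝ≥0∞) ^ d * (c * μ (A N))
        = c * (((2 * N + 1 : ℕ) : ℝ≥0∞) ^ d * μ (A N)) := by ring
      _ ≤ 2 ^ d * (((2 * (N + N) + 1 : ℕ) : ℝ≥0∞) ^ d * ∫⁻ x, v x ∂μ) := h2
      _ ≤ 2 ^ d * ((2 ^ d * ((2 * N + 1 : ℕ) : ℝ≥0∞) ^ d) * ∫⁻ x, v x ∂μ) := by gcongr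
      _ = ((2 * N + 1 : ℕ) : ℝ≥0∞) ^ d * (4 ^ d * ∫⁻ x, v x ∂μ) := by
        rw [show (4 : ℝ≥0∞) = 2 * 2 by norm_num, mul_pow]
        ring
  have hU : {x | ∃ n : ℕ, c * ((2 * n + 1 : ℕ) : ℝ≥0∞) ^ d ≤ ∑ y ∈ box 0 n, v (S y x)} =
      ⋃ N, A N := by
    ext x
    simp only [A, Set.mem_ofPred_eq, Set.mem_iUnion]
    exact ⟨fun ⟨n, hn⟩ => ⟨n, n, le_rfl, hn⟩, fun ⟨_, n, _, hn⟩ => ⟨n, hn⟩⟩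
  have hmono : Monotone A := fun M N hMN x ⟨n, hn, h⟩ => ⟨n, hn.trans hMN, h⟩
  rw [hU, hmono.measure_iUnion, ENNReal.mul_iSup]
  exact iSup_le hN

end Maximal

/-! ### Fixed points of isometries in Hilbert space -/

section Hilbert

open scoped RealInnerProductSpace

/-- The point of smallest norm in the closed convex hull of an orbit of isometries is fixed. -/
theorem exists_fixed_mem_closure_convexHull {H A : Type*} [NormedAddCommGroup H]
    [InnerProductSpace ℝ H] [CompleteSpace H] (U : A → H →ₗᵢ[ℝ] H) {O : Set H} (hO : O.Nonempty)
    (hU : ∀ a, Set.MapsTo (U a) O O) :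
    ∃ u ∈ closure (convexHull ℝ O), ∀ a, U a u = u := by
  have hconv : Convex ℝ (closure (convexHull ℝ O)) := (convex_convexHull ℝ O).closure
  obtain ⟨u, hu, hmin⟩ := exists_norm_eq_iInf_of_complete_convex
    (hO.convexHull (𝕜 := ℝ)).closure isClosed_closure.isComplete hconv 0
  rw [norm_eq_iInf_iff_real_inner_le_zero hconv hu] at hmin
  refine ⟨u, hu, fun a => ?_⟩
  have hmaps : Set.MapsTo (U a) (convexHull ℝ O) (convexHull ℝ O) := by
    intro x hx
    have h : U a x ∈ (U a).toLinearMap '' convexHull ℝ O := ⟨x, hx, rfl⟩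
    rw [LinearMap.image_convexHull] at h
    exact convexHull_mono (Set.image_subset_iff.2 (hU a)) h
  have hw : U a u ∈ closure (convexHull ℝ O) := hmaps.closure (U a).continuous hu
  -- Minimality of `u` tested against `U a u` gives `⟪u, u⟫ ≤ ⟪u, U a u⟫`. As the norms agree, `‖U a
  -- u - u‖² ≤ 0`.
  have h1 := hmin _ hw
  have hn : ⟪U a u, U a u⟫ = ⟪u, u⟫ := (U a).inner_map_map u u
  rw [zero_sub, inner_neg_left, inner_sub_right] at h1
  have h2 : ⟪U a u - u, U a u - u⟫ ≤ 0 := by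
    rw [inner_sub_left, inner_sub_right, inner_sub_right, hn, real_inner_comm u (U a u)]
    linarith
  exact sub_eq_zero.1 (inner_self_eq_zero.1 (le_antisymm h2 real_inner_self_nonneg))

end Hilbert

/-! ### A mean ergodic theorem by convex combinations -/

section MeanErgodic

open scoped ENNReal

variable {X A : Type*} [MeasurableSpace X] {μ : Measure X} [IsProbabilityMeasure μ]

theorem integral_comp_of_measurePreserving {Y : Type*} [MeasurableSpace Y] {ν : Measure Y}
    {T : Y → Y} (hT : MeasurePreserving T ν ν) {f : Y → ℝ} (hf : AEStronglyMeasurable f ν) :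
    ∫ x, f (T x) ∂ν = ∫ x, f x ∂ν := by
  have h := integral_map (μ := ν) hT.measurable.aemeasurable (f := f) (by rwa [hT.map_eq])
  rw [hT.map_eq] at h
  exact h.symm

/-- Preimages of measurable sets under `g` are invariant up to null sets, so each has probability
`0` or `1`. Countably many measurable sets separate the reals, which pins `g` to a single value. -/
theorem exists_ae_eq_const_of_invariant {T : A → X → X}
    (herg : ∀ Θ, MeasurableSet Θ → (∀ a, μ (symmDiff (T a ⁻¹' Θ) Θ) = 0) → μ Θ = 0 ∨ μ Θ = 1)
    (hT : ∀ a, MeasurePreserving (T a) μ μ)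
    {g : X → ℝ} (hg : AEStronglyMeasurable g μ) (hinv : ∀ a, g ∘ T a =ᵐ[μ] g) :
    ∃ c : ℝ, g =ᵐ[μ] fun _ => c := by
  have hm := hg.stronglyMeasurable_mk.measurable
  have he := hg.ae_eq_mk
  have hinv' : ∀ a, hg.mk g ∘ T a =ᵐ[μ] hg.mk g := fun a =>
    (((hT a).quasiMeasurePreserving.ae_eq_comp he).symm.trans (hinv a)).trans he
  obtain ⟨c, hc⟩ := exists_eventuallyEq_const_of_forall_separating (l := ae μ) (f := hg.mk g)
    MeasurableSet fun U hU => by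
      have h := herg (hg.mk g ⁻¹' U) (hm hU) fun a => by
        rw [measure_symmDiff_eq_zero_iff]
        filter_upwards [hinv' a] with x hx
        apply propext
        change hg.mk g (T a x) ∈ U ↔ hg.mk g x ∈ U
        rw [show hg.mk g (T a x) = hg.mk g x from hx]
      rcases h with h | h
      · exact Or.inr (measure_eq_zero_iff_ae_notMem.1 h)
      · exact Or.inl ((prob_compl_eq_zero_iff (hm hU)).2 h)
  exact ⟨c, he.trans hc⟩

/-- Some convex combination of translates of a square integrable function is close to its mean. -/
theorem exists_convexCombination_close {T : A → X → X} [Nonempty A]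
    (hT : ∀ a, MeasurePreserving (T a) μ μ) (hcomp : ∀ a b, ∃ c, T a ∘ T b = T c)
    (herg : ∀ Θ, MeasurableSet Θ → (∀ a, μ (symmDiff (T a ⁻¹' Θ) Θ) = 0) → μ Θ = 0 ∨ μ Θ = 1)
    {f : X → ℝ} (hf : MemLp f 2 μ) {ε : ℝ} (hε : 0 < ε) :
    ∃ (ι : Type) (t : Finset ι) (w : ι → ℝ) (a : ι → A), (∀ i ∈ t, 0 ≤ w i) ∧ ∑ i ∈ t, w i = 1 ∧
      ∫ x, |∑ i ∈ t, w i * f (T (a i) x) - ∫ y, f y ∂μ| ∂μ ≤ ε := by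
  -- Composition with `T a` is an isometry of `L²`, and `hcomp` makes the orbit of `f` stable. The
  -- fixed point in its closed convex hull is constant by ergodicity.
  let U : A → Lp ℝ 2 μ →ₗᵢ[ℝ] Lp ℝ 2 μ := fun a => Lp.compMeasurePreservingₗᵢ ℝ (T a) (hT a)
  let f' : Lp ℝ 2 μ := hf.toLp f
  have hUf : ∀ a, (U a f' : X → ℝ) =ᵐ[μ] fun x => f (T a x) := fun a =>
    (hf.comp_measurePreserving (hT a)).coeFn_toLp
  obtain ⟨u, hu, hfix⟩ := exists_fixed_mem_closure_convexHull U (O := Set.range fun a => U a f')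
    (Set.range_nonempty _) (by
      rintro a _ ⟨b, rfl⟩
      obtain ⟨c, hc⟩ := hcomp b a
      refine ⟨c, ?_⟩
      apply Lp.ext
      refine (hUf c).trans ?_
      refine ((Lp.coeFn_compMeasurePreserving _ (hT a)).trans
        ((hT a).quasiMeasurePreserving.ae_eq_comp (hUf b)) |>.trans ?_).symm
      refine Eventually.of_forall fun x => ?_
      change f (T b (T a x)) = f (T c x)
      rw [← hc]
      rfl)
  obtain ⟨c, hc⟩ := exists_ae_eq_const_of_invariant herg hT (Lp.aestronglyMeasurable u) fun a => by
    have h := Lp.coeFn_compMeasurePreserving u (hT a)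
    have h' : Lp.compMeasurePreserving (T a) (hT a) u = u := hfix a
    rw [h'] at h
    exact h.symm
  obtain ⟨g, hg, hgu⟩ := Metric.mem_closure_iff.1 hu (ε / 2) (half_pos hε)
  rw [convexHull_eq] at hg
  obtain ⟨ι, t, w, z, hw0, hw1, hz, rfl⟩ := hg
  have hz' : ∀ i, ∃ a, i ∈ t → U a f' = z i := by
    intro i
    by_cases hi : i ∈ t
    · obtain ⟨a, ha⟩ := hz i hi
      exact ⟨a, fun _ => ha⟩
    · exact ⟨Classical.arbitrary A, fun h => absurd h hi⟩
  choose a ha using hz'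
  refine ⟨ι, t, w, a, hw0, hw1, ?_⟩
  rw [Finset.centerMass_eq_of_sum_1 _ _ hw1] at hgu
  set g : X → ℝ := fun x => ∑ i ∈ t, w i * f (T (a i) x) with hgdef
  have hgL : ((∑ i ∈ t, w i • z i : Lp ℝ 2 μ) : X → ℝ) =ᵐ[μ] g := by
    have h : ∀ᵐ x ∂μ, ∀ i ∈ t, (w i • z i : Lp ℝ 2 μ) x = w i * f (T (a i) x) := by
      refine (eventually_all_finset t).2 fun i hi => ?_
      rw [← ha i hi]
      filter_upwards [Lp.coeFn_smul (w i) (U (a i) f'), hUf (a i)] with x h1 h2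
      rw [h1, Pi.smul_apply, h2, smul_eq_mul]
    filter_upwards [Lp.coeFn_fun_finsetSum t fun i => (w i • z i : Lp ℝ 2 μ), h] with x h1 h2
    rw [h1]
    exact Finset.sum_congr rfl h2
  have hfi : Integrable f μ := hf.integrable (by norm_num)
  have hfTi : ∀ a, Integrable (fun x => f (T a x)) μ := fun a =>
    (hT a).integrable_comp_of_integrable hfi
  have hgi : Integrable g μ := integrable_finsetSum _ fun i _ => (hfTi (a i)).const_mul _
  have hgm : ∫ x, g x ∂μ = ∫ x, f x ∂μ := by
    rw [hgdef, integral_finsetSum _ fun i _ => (hfTi (a i)).const_mul _]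
    have h : ∀ i, ∫ x, w i * f (T (a i) x) ∂μ = w i * ∫ x, f x ∂μ := by
      intro i
      rw [integral_const_mul, integral_comp_of_measurePreserving (hT (a i)) hf.aestronglyMeasurable]
    simp only [h]
    rw [← Finset.sum_mul, hw1, one_mul]
  have hdist : ∫ x, |g x - c| ∂μ ≤ ε / 2 := by
    set q : Lp ℝ 2 μ := ∑ i ∈ t, w i • z i
    calc ∫ x, |g x - c| ∂μ = ∫ x, ‖(q - u : Lp ℝ 2 μ) x‖ ∂μ := by
          refine integral_congr_ae ?_
          filter_upwards [Lp.coeFn_sub q u, hgL, hc] with x h1 h2 h3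
          rw [h1, Pi.sub_apply, h2, h3, Real.norm_eq_abs]
      _ = (eLpNorm (q - u : Lp ℝ 2 μ) 1 μ).toReal := by
          rw [integral_norm_eq_lintegral_enorm (Lp.aestronglyMeasurable _),
            eLpNorm_one_eq_lintegral_enorm]
      _ ≤ (eLpNorm (q - u : Lp ℝ 2 μ) 2 μ).toReal :=
          ENNReal.toReal_mono (Lp.eLpNorm_ne_top _)
            (eLpNorm_le_eLpNorm_of_exponent_le (by norm_num) (Lp.aestronglyMeasurable _))
      _ = dist u q := by rw [dist_comm, dist_eq_norm, Lp.norm_def]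
      _ ≤ ε / 2 := hgu.le
  -- The combination `g` has the same mean as `f`, so the unknown constant `c` is within `ε / 2` of
  -- that mean.
  have hmean : |∫ x, f x ∂μ - c| ≤ ε / 2 := by
    rw [← hgm]
    have : ∫ x, g x ∂μ - c = ∫ x, (g x - c) ∂μ := by
      rw [integral_sub hgi (integrable_const _)]
      simp
    rw [this]
    exact (abs_integral_le_integral_abs).trans hdist
  calc ∫ x, |g x - ∫ y, f y ∂μ| ∂μ ≤ ∫ x, (|g x - c| + ε / 2) ∂μ := by
        refine integral_mono (hgi.sub (integrable_const _)).abs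
          ((hgi.sub (integrable_const _)).abs.add (integrable_const _)) fun x => ?_
        have := abs_sub_le (g x) c (∫ y, f y ∂μ)
        rw [abs_sub_comm c] at this
        exact this.trans (by gcongr)
    _ ≤ ε := by
        have h := integral_add (hgi.sub (integrable_const c)).abs
          (integrable_const (μ := μ) (ε / 2))
        simp only [Pi.sub_apply] at h
        rw [h]
        simp only [integral_const, probReal_univ, one_smul]
        linarith

end MeanErgodic

/-! ### Sandwich arguments for real functions of the window size -/

section RealAnalysis

/-- A function of `l` squeezed between multiples of the volumes of unions of `(2 n + 1) ^ d` cubes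
of side `m` grows like `l ^ d`. -/
theorem eventually_div_pow_mem_Icc {d : ℕ} {V : ℝ → ℝ} (hV : ∀ l, 0 ≤ V l) {m R α β : ℝ}
    (hm : 0 < m) (hR : 0 ≤ R) (hβ : 0 ≤ β)
    (hupper : ∀ (l : ℝ) (n : ℕ), l / 2 + R ≤ n * m → V l ≤ ((2 * n + 1) * m) ^ d * β)
    (hlower : ∀ (l : ℝ) (n : ℕ), (n + 1) * m + R ≤ l / 2 → ((2 * n + 1) * m) ^ d * α ≤ V l)
    {η : ℝ} (hη : 0 < η) : ∀ᶠ l in atTop, V l / l ^ d ∈ Set.Icc (α - η) (β + η) := by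
  have hlim : ∀ c γ : ℝ, Tendsto (fun l : ℝ => ((l + c) / l) ^ d * γ) atTop (𝓝 γ) := by
    intro c γ
    have h1 : Tendsto (fun l : ℝ => 1 + c / l) atTop (𝓝 (1 + 0)) :=
      tendsto_const_nhds.add (tendsto_const_nhds.div_atTop tendsto_id)
    have h2 := (h1.pow d).mul_const γ
    rw [add_zero, one_pow, one_mul] at h2
    refine h2.congr' ?_
    filter_upwards [eventually_gt_atTop 0] with l hl
    rw [add_div, div_self hl.ne']
  have hu : ∀ᶠ l in atTop, V l / l ^ d ≤ β + η := by
    filter_upwards [eventually_gt_atTop 0,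
      (hlim (2 * R + 3 * m) β).eventually_lt_const (lt_add_of_pos_right β hη)] with l hl h
    refine le_trans ?_ h.le
    -- With this rounding `(2 * n + 1) * m ≤ l + 2 * R + 3 * m`.
    set n := ⌈(l / 2 + R) / m⌉₊
    have h1 : (l / 2 + R) / m ≤ n := Nat.le_ceil _
    have h2 : (n : ℝ) < (l / 2 + R) / m + 1 := Nat.ceil_lt_add_one (by positivity)
    rw [div_le_iff₀ hm] at h1
    rw [← sub_lt_iff_lt_add, lt_div_iff₀ hm] at h2
    rw [div_pow, div_mul_eq_mul_div]
    refine div_le_div_of_nonneg_right ((hupper l n h1).trans ?_) (by positivity)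
    refine mul_le_mul_of_nonneg_right (pow_le_pow_left₀ (by positivity) ?_ d) hβ
    linarith
  have hl : ∀ᶠ l in atTop, α - η ≤ V l / l ^ d := by
    -- In the application `α` is a mean minus `δ` and may be negative; then `V ≥ 0` suffices.
    rcases le_or_gt α 0 with hα | hα
    · filter_upwards [eventually_gt_atTop 0] with l hl
      have : 0 ≤ V l / l ^ d := div_nonneg (hV l) (by positivity)
      linarith
    -- The threshold makes the floor below at least `1`, so that it is some `n + 1`, and keeps `l -
    -- 2 * R - 3 * m`, the lower bound for `(2 * n + 1) * m`, nonnegative.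
    · filter_upwards [eventually_gt_atTop 0, eventually_ge_atTop (2 * R + 4 * m),
        (hlim (-(2 * R + 3 * m)) α).eventually_const_lt (sub_lt_self α hη)] with l hl hl' h
      refine h.le.trans ?_
      have hpos : 0 ≤ (l / 2 - R) / m := div_nonneg (by linarith) hm.le
      set N := ⌊(l / 2 - R) / m⌋₊
      have h1 : (N : ℝ) ≤ (l / 2 - R) / m := Nat.floor_le hpos
      have h2 : (l / 2 - R) / m < N + 1 := Nat.lt_floor_add_one _
      have h3 : 1 ≤ N := Nat.le_floor (by
        rw [le_div_iff₀ hm]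
        push_cast
        linarith)
      obtain ⟨n, hn⟩ : ∃ n, N = n + 1 := ⟨N - 1, by omega⟩
      rw [hn] at h1 h2
      push_cast at h1 h2
      rw [le_div_iff₀ hm] at h1
      rw [div_lt_iff₀ hm] at h2
      rw [div_pow, div_mul_eq_mul_div]
      refine div_le_div_of_nonneg_right (le_trans ?_ (hlower l n (by linarith))) (by positivity)
      refine mul_le_mul_of_nonneg_right (pow_le_pow_left₀ (by linarith) ?_ d) hα.le
      linarith
  filter_upwards [hu, hl] with l h1 h2 using ⟨h2, h1⟩

/-- Comparing two indices at a common large `l` gives `a m' ≤ a m + κ m`. The supremum of `a`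
therefore lies in every interval `[a m, a m + κ m]`, and these shrink. -/
theorem exists_limit_of_eventually_mem_Icc {M : ℝ → ℝ} {a κ : ℕ → ℝ}
    (hκ : Tendsto κ atTop (𝓝 0))
    (h : ∀ m, ∀ η > 0, ∀ᶠ l in atTop, M l ∈ Set.Icc (a m - η) (a m + κ m + η)) :
    ∃ e, (∀ m, a m ≤ e ∧ e ≤ a m + κ m) ∧ Tendsto M atTop (𝓝 e) := by
  have hle : ∀ m m', a m' ≤ a m + κ m := by
    intro m m'
    refine le_of_forall_pos_le_add fun η hη => ?_
    obtain ⟨l, h1, h2⟩ := ((h m (η / 2) (half_pos hη)).and (h m' (η / 2) (half_pos hη))).exists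
    linarith [h1.2, h2.1]
  have hbdd : BddAbove (Set.range a) := ⟨a 0 + κ 0, by
    rintro _ ⟨m, rfl⟩
    exact hle 0 m⟩
  have he : ∀ m, a m ≤ (⨆ m, a m) ∧ (⨆ m, a m) ≤ a m + κ m := fun m =>
    ⟨le_ciSup hbdd m, ciSup_le (hle m)⟩
  refine ⟨⨆ m, a m, he, ?_⟩
  rw [Metric.tendsto_nhds]
  intro ε hε
  obtain ⟨m, hm⟩ := (hκ.eventually_lt_const (half_pos hε)).exists
  filter_upwards [h m (ε / 4) (by positivity)] with l hl
  have h1 := he m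
  rw [Real.dist_eq, abs_lt]
  constructor <;> linarith [hl.1, hl.2, h1.1, h1.2]

end RealAnalysis

/-! ### Tiles inside and around a window; the fraction of boundary cells -/

section Geometry

variable {d : ℕ}

theorem window_subset_biUnion_tile {a : EuclideanSpace ℝ (Fin d)} {R l : ℝ} {m n : ℕ}
    (hm : 0 < m) (ha : ∀ i, |a i| ≤ R) (h : l / 2 + R ≤ n * m) :
    window d l ⊆ ⋃ z ∈ box (0 : Fin d → ℤ) n, tile a m z := by
  intro x hx
  have hm' : (0 : ℝ) < m := by exact_mod_cast hm
  simp only [Set.mem_iUnion]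
  refine ⟨fun i => ⌊(x i - a i) / m⌋, mem_box.2 fun i => ?_, (mem_tile hm).2 fun i => rfl⟩
  obtain ⟨h1, h2⟩ := hx i
  have h3 := abs_le.1 (ha i)
  simp only [Pi.zero_apply, zero_sub, zero_add]
  constructor
  · rw [Int.le_floor, le_div_iff₀ hm']
    push_cast
    linarith
  · refine Int.lt_add_one_iff.1 (Int.floor_lt.2 ?_)
    rw [div_lt_iff₀ hm']
    push_cast
    linarith

theorem tile_subset_window {a : EuclideanSpace ℝ (Fin d)} {R l : ℝ} {m n : ℕ}
    (ha : ∀ i, |a i| ≤ R) (h : (n + 1) * m + R ≤ l / 2) {z : Fin d → ℤ}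
    (hz : z ∈ box (0 : Fin d → ℤ) n) : tile a m z ⊆ window d l := by
  intro x hx i
  obtain ⟨h1, h2⟩ := hx i
  have h3 := abs_le.1 (ha i)
  have h4 := mem_box.1 hz i
  simp only [Pi.zero_apply, zero_sub, zero_add] at h4
  have h5 : -(n : ℝ) ≤ z i := by exact_mod_cast h4.1
  have h6 : (z i : ℝ) ≤ n := by exact_mod_cast h4.2
  have h7 : -(n : ℝ) * m ≤ m * z i := by nlinarith [(Nat.cast_nonneg m : (0 : ℝ) ≤ m)]
  have h8 : (m : ℝ) * z i ≤ n * m := by nlinarith [(Nat.cast_nonneg m : (0 : ℝ) ≤ m)]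
  simp only [PiLp.add_apply, PiLp.smul_apply, latticePoint_apply, smul_eq_mul] at h1 h2
  have h9 : (0 : ℝ) ≤ m := Nat.cast_nonneg m
  constructor <;> linarith

theorem isBounded_window (d : ℕ) (l : ℝ) : Bornology.IsBounded (window d l) :=
  window_eq_cell d l ▸ isBounded_cell _ _

theorem translate_neg_add (a b : EuclideanSpace ℝ (Fin d)) (φ : CountingMeasure d) :
    translate (-(a + b)) φ = translate (-a) (translate (-b) φ) := by
  rw [neg_add, translate_add]

theorem boundaryCount_nonneg (m ρ n : ℕ) (φ : CountingMeasure d) : 0 ≤ boundaryCount m ρ n φ :=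
  Finset.sum_nonneg fun _ _ => by positivity

theorem tileError_nonneg (m ρ k : ℕ) (φ : CountingMeasure d) : 0 ≤ tileError m ρ k φ :=
  mul_nonneg zero_le_two (add_nonneg (boundaryCount_nonneg _ _ _ _) (boundaryCount_nonneg _ _ _ _))

theorem measurable_boundaryCount (m ρ n : ℕ) :
    Measurable (boundaryCount m ρ n : CountingMeasure d → ℝ) :=
  Finset.measurable_fun_sum _ fun _ _ =>
    ((measurable_apply (measurableSet_cell _ _)).ennreal_toReal).pow_const _

theorem measurable_tileError (m ρ k : ℕ) :
    Measurable (tileError m ρ k : CountingMeasure d → ℝ) :=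
  ((measurable_boundaryCount _ _ _).add (measurable_boundaryCount _ _ _)).const_mul _

theorem tendsto_card_boundaryCells_div (d ρ : ℕ) :
    Tendsto (fun m : ℕ => ((boundaryCells d m ρ).card : ℝ) / (m : ℝ) ^ d) atTop (𝓝 0) := by
  have h1 : Tendsto (fun m : ℕ => 1 - (1 - (2 * ρ : ℝ) / m) ^ d) atTop (𝓝 (1 - (1 - 0) ^ d)) :=
    tendsto_const_nhds.sub ((tendsto_const_nhds.sub
      (tendsto_const_nhds.div_atTop tendsto_natCast_atTop_atTop)).pow d)
  rw [sub_zero, one_pow, sub_self] at h1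
  refine h1.congr' ?_
  filter_upwards [eventually_ge_atTop (2 * ρ), eventually_gt_atTop 0] with m hm hm'
  have hm0 : (m : ℝ) ≠ 0 := by exact_mod_cast hm'.ne'
  rw [card_boundaryCells hm, Nat.cast_sub (Nat.pow_le_pow_left (Nat.sub_le _ _) d)]
  push_cast [hm]
  rw [sub_div, div_self (pow_ne_zero _ hm0), ← div_pow, sub_div, div_self hm0]

end Geometry

/-! ### Integrability and convergence of the means -/

section StationaryErgodic

open scoped ENNReal

variable {d : ℕ} {μ : Measure (CountingMeasure d)}
  {G : PreAbstractSimplicialComplex (EuclideanSpace ℝ (Fin d)) → ℕ} {k : ℕ}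

theorem IsAlmostAdditive.measurable_cech (hG : IsAlmostAdditive G k)
    {B : Set (EuclideanSpace ℝ (Fin d))} (hB : MeasurableSet B) (hb : Bornology.IsBounded B)
    (r : ℝ) : Measurable fun φ : CountingMeasure d => (G (cech (points φ ∩ B) r) : ℝ) := by
  classical
  refine measurable_cech_of_map (fun f K hK hf => ?_) hB hb r
  exact hG.map f K hK hf

/-- `G` is bounded by powers of the number of points. Square integrability is what the Hilbert space
argument requires. -/
theorem IsAlmostAdditive.memLp_cech (hG : IsAlmostAdditive G k)
    (hmom : ∀ a s n, Integrable (fun φ : CountingMeasure d => (φ.1 (cell a s)).toReal ^ n) μ)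
    (a : EuclideanSpace ℝ (Fin d)) (s r : ℝ) :
    MemLp (fun φ : CountingMeasure d => (G (cech (points φ ∩ cell a s) r) : ℝ)) 2 μ := by
  have hp : ∀ n, MemLp (fun φ : CountingMeasure d => (φ.1 (cell a s)).toReal ^ n) 2 μ := by
    intro n
    rw [memLp_two_iff_integrable_sq
      ((measurable_apply (measurableSet_cell a s)).ennreal_toReal.pow_const n).aestronglyMeasurable]
    simpa only [← pow_mul] using hmom a s (n * 2)
  refine (((hp (k + 1)).add (hp (k + 2))).const_mul 2).mono
    (hG.measurable_cech (measurableSet_cell a s) (isBounded_cell a s) r).aestronglyMeasurable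
    (Eventually.of_forall fun φ => ?_)
  have h1 := hG.cech_le (finite_points_inter φ (isBounded_cell a s)) r
  have h2 := ncard_points_inter_le φ (isBounded_cell a s)
  have h3 : (G (cech (points φ ∩ cell a s) r) : ℝ) ≤ _ := Nat.cast_le.2 h1
  push_cast at h3
  rw [Real.norm_of_nonneg (Nat.cast_nonneg _), Real.norm_of_nonneg (by simp only [Pi.add_apply]; positivity)]
  refine h3.trans ?_
  simp only [Pi.add_apply]
  gcongr

theorem IsAlmostAdditive.integrable_cech_window [IsFiniteMeasure μ] (hG : IsAlmostAdditive G k)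
    (hmom : ∀ a s n, Integrable (fun φ : CountingMeasure d => (φ.1 (cell a s)).toReal ^ n) μ)
    (r l : ℝ) :
    Integrable (fun φ : CountingMeasure d => (G (cech (points φ ∩ window d l) r) : ℝ)) μ := by
  rw [window_eq_cell]
  exact (hG.memLp_cech hmom _ _ r).integrable (by norm_num)

theorem integrable_boundaryCount
    (hmom : ∀ a s n, Integrable (fun φ : CountingMeasure d => (φ.1 (cell a s)).toReal ^ n) μ)
    (m ρ n : ℕ) : Integrable (boundaryCount m ρ n : CountingMeasure d → ℝ) μ :=
  integrable_finsetSum _ fun _ _ => hmom _ _ _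

theorem integral_boundaryCount (hT : ∀ a, MeasurePreserving (translate a) μ μ)
    (hmom : ∀ a s n, Integrable (fun φ : CountingMeasure d => (φ.1 (cell a s)).toReal ^ n) μ)
    (m ρ n : ℕ) : ∫ φ, boundaryCount m ρ n φ ∂μ = (boundaryCells d m ρ).card *
      ∫ φ, (φ.1 (cell (-diagonalPoint d ρ) (1 + 2 * ρ))).toReal ^ n ∂μ := by
  simp only [boundaryCount]
  rw [integral_finsetSum _ fun _ _ => hmom _ _ _, ← nsmul_eq_mul, ← Finset.sum_const]
  refine Finset.sum_congr rfl fun u _ => ?_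
  rw [← integral_comp_of_measurePreserving (hT (-latticePoint u))
    (hmom (-diagonalPoint d ρ) (1 + 2 * ρ) n).aestronglyMeasurable]
  simp only [measure_translate_cell, sub_eq_add_neg]

theorem integrable_tileError
    (hmom : ∀ a s n, Integrable (fun φ : CountingMeasure d => (φ.1 (cell a s)).toReal ^ n) μ)
    (m ρ k : ℕ) : Integrable (tileError m ρ k : CountingMeasure d → ℝ) μ :=
  ((integrable_boundaryCount hmom _ _ _).add (integrable_boundaryCount hmom _ _ _)).const_mul _

/-- By stationarity every boundary cell contributes the same moments, and boundary cells are a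
vanishing fraction of the cube. -/
theorem tendsto_integral_tileError_div (hT : ∀ a, MeasurePreserving (translate a) μ μ)
    (hmom : ∀ a s n, Integrable (fun φ : CountingMeasure d => (φ.1 (cell a s)).toReal ^ n) μ)
    (ρ k : ℕ) :
    Tendsto (fun m : ℕ => (∫ φ, tileError m ρ k φ ∂μ) / (m : ℝ) ^ d) atTop (𝓝 0) := by
  have h := (tendsto_card_boundaryCells_div d ρ).mul_const
    (2 * (∫ φ, (φ.1 (cell (-diagonalPoint d ρ) (1 + 2 * ρ))).toReal ^ (k + 1) ∂μ +
      ∫ φ, (φ.1 (cell (-diagonalPoint d ρ) (1 + 2 * ρ))).toReal ^ (k + 2) ∂μ))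
  rw [zero_mul] at h
  refine h.congr fun m => ?_
  simp only [tileError]
  rw [integral_const_mul, integral_add (integrable_boundaryCount hmom _ _ _)
    (integrable_boundaryCount hmom _ _ _), integral_boundaryCount hT hmom,
    integral_boundaryCount hT hmom]
  ring

theorem integral_sum_translate (hT : ∀ a, MeasurePreserving (translate a) μ μ)
    {g : CountingMeasure d → ℝ} (hg : Integrable g μ) {ι : Type*} (s : Finset ι)
    (b : ι → EuclideanSpace ℝ (Fin d)) :
    ∫ φ, ∑ z ∈ s, g (translate (b z) φ) ∂μ = s.card * ∫ φ, g φ ∂μ := by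
  have h : ∀ z, Integrable (fun φ => g (translate (b z) φ)) μ := fun z =>
    (hT (b z)).integrable_comp_of_integrable hg
  rw [integral_finsetSum _ fun z _ => h z,
    Finset.sum_congr rfl fun z _ =>
      integral_comp_of_measurePreserving (hT (b z)) hg.aestronglyMeasurable,
    Finset.sum_const, nsmul_eq_mul]

/-- The values of the functional on a window, compared with averages over shifted tilings. -/
theorem IsAlmostAdditive.window_le_sum_box (hG : IsAlmostAdditive G k) {r : ℝ} {ρ : ℕ}
    (hρ : 2 * r ≤ ρ) {m : ℕ} (hm : 0 < m) {ι : Type*} (t : Finset ι) {w : ι → ℝ}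
    (hw0 : ∀ i ∈ t, 0 ≤ w i) (hw1 : ∑ i ∈ t, w i = 1) {a : ι → EuclideanSpace ℝ (Fin d)} {R : ℝ}
    (ha : ∀ i ∈ t, ∀ j, |a i j| ≤ R) (φ : CountingMeasure d) {l : ℝ} {n : ℕ}
    (hl : l / 2 + R ≤ n * m) :
    (G (cech (points φ ∩ window d l) r) : ℝ) ≤ ∑ z ∈ box (0 : Fin d → ℤ) n,
      (∑ i ∈ t, w i * (G (cech (points (translate (-(a i))
        (translate (-((m : ℝ) • latticePoint z)) φ)) ∩ cell 0 m) r) : ℝ) +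
      ∑ i ∈ t, w i * tileError m ρ k (translate (-(a i))
        (translate (-((m : ℝ) • latticePoint z)) φ))) := by
  calc (G (cech (points φ ∩ window d l) r) : ℝ)
      = ∑ i ∈ t, w i * (G (cech (points φ ∩ window d l) r) : ℝ) := by
        rw [← Finset.sum_mul, hw1, one_mul]
    _ ≤ ∑ i ∈ t, w i * ∑ z ∈ box (0 : Fin d → ℤ) n,
        ((G (cech (points (translate (-(a i + (m : ℝ) • latticePoint z)) φ) ∩ cell 0 m) r) : ℝ) +
        tileError m ρ k (translate (-(a i + (m : ℝ) • latticePoint z)) φ)) :=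
        Finset.sum_le_sum fun i hi => mul_le_mul_of_nonneg_left
          (hG.le_sum_tile φ (a i) hm hρ _ (window_subset_biUnion_tile hm (ha i hi) hl)) (hw0 i hi)
    _ = _ := by
        simp only [translate_neg_add, ← Finset.sum_add_distrib, Finset.mul_sum, mul_add]
        rw [Finset.sum_comm]

theorem IsAlmostAdditive.sum_box_le_window (hG : IsAlmostAdditive G k) (r : ℝ)
    {m : ℕ} (hm : 0 < m) {ι : Type*} (t : Finset ι) {w : ι → ℝ}
    (hw0 : ∀ i ∈ t, 0 ≤ w i) (hw1 : ∑ i ∈ t, w i = 1) {a : ι → EuclideanSpace ℝ (Fin d)} {R : ℝ}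
    (ha : ∀ i ∈ t, ∀ j, |a i j| ≤ R) (φ : CountingMeasure d) {l : ℝ} {n : ℕ}
    (hl : (n + 1) * m + R ≤ l / 2) :
    ∑ z ∈ box (0 : Fin d → ℤ) n,
      ∑ i ∈ t, w i * (G (cech (points (translate (-(a i))
        (translate (-((m : ℝ) • latticePoint z)) φ)) ∩ cell 0 m) r) : ℝ) ≤
    G (cech (points φ ∩ window d l) r) := by
  calc ∑ z ∈ box (0 : Fin d → ℤ) n,
      ∑ i ∈ t, w i * (G (cech (points (translate (-(a i))
        (translate (-((m : ℝ) • latticePoint z)) φ)) ∩ cell 0 m) r) : ℝ)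
      = ∑ i ∈ t, w i * ∑ z ∈ box (0 : Fin d → ℤ) n,
        (G (cech (points (translate (-(a i + (m : ℝ) • latticePoint z)) φ) ∩ cell 0 m) r) : ℝ) := by
        simp only [translate_neg_add, Finset.mul_sum]
        rw [Finset.sum_comm]
    _ ≤ ∑ i ∈ t, w i * (G (cech (points φ ∩ window d l) r) : ℝ) :=
        Finset.sum_le_sum fun i hi => mul_le_mul_of_nonneg_left
          (hG.sum_tile_le φ (a i) hm r _ (isBounded_window d l)
            fun z hz => tile_subset_window (ha i hi) hl hz) (hw0 i hi)
    _ = G (cech (points φ ∩ window d l) r) := by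
        rw [← Finset.sum_mul, hw1, one_mul]

/-- The mean of the functional on a large window lies between the means over tiles, without and
with the error terms. -/
theorem IsAlmostAdditive.eventually_mean_mem_Icc [IsFiniteMeasure μ]
    (hG : IsAlmostAdditive G k)
    (hT : ∀ a, MeasurePreserving (translate a) μ μ)
    (hmom : ∀ a s n, Integrable (fun φ : CountingMeasure d => (φ.1 (cell a s)).toReal ^ n) μ)
    {r : ℝ} {ρ : ℕ} (hρ : 2 * r ≤ ρ) {m : ℕ} (hm : 0 < m) {η : ℝ} (hη : 0 < η) :
    ∀ᶠ l : ℝ in atTop, (∫ φ, (G (cech (points φ ∩ window d l) r) : ℝ) ∂μ) / l ^ d ∈ Set.Icc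
      ((∫ φ, (G (cech (points φ ∩ cell 0 m) r) : ℝ) ∂μ) / (m : ℝ) ^ d - η)
      ((∫ φ, (G (cech (points φ ∩ cell 0 m) r) : ℝ) ∂μ) / (m : ℝ) ^ d +
        (∫ φ, tileError m ρ k φ ∂μ) / (m : ℝ) ^ d + η) := by
  have hm' : (0 : ℝ) < m := by exact_mod_cast hm
  set f : CountingMeasure d → ℝ := fun φ => (G (cech (points φ ∩ cell 0 m) r) : ℝ)
  have hf : Integrable f μ := (hG.memLp_cech hmom 0 m r).integrable (by norm_num)
  have he : Integrable (tileError m ρ k : CountingMeasure d → ℝ) μ := integrable_tileError hmom _ _ _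
  have hcomp : ∀ {g : CountingMeasure d → ℝ}, Integrable g μ → ∀ a,
      Integrable (fun φ => g (translate a φ)) μ := fun hg a => (hT a).integrable_comp_of_integrable hg
  -- For the mean a single unshifted tiling of weight `1` suffices.
  have hzero : ∀ i ∈ ({()} : Finset Unit), ∀ j,
      |(fun _ => 0 : Unit → EuclideanSpace ℝ (Fin d)) i j| ≤ 0 := by simp
  have hw0 : ∀ i ∈ ({()} : Finset Unit), (0 : ℝ) ≤ (fun _ => 1 : Unit → ℝ) i := by simp
  have hw1 : ∑ i ∈ ({()} : Finset Unit), (fun _ => 1 : Unit → ℝ) i = 1 := by simp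
  refine eventually_div_pow_mem_Icc (R := 0) (m := m) (fun l => integral_nonneg fun φ => Nat.cast_nonneg _)
    hm' le_rfl ?_ ?_ ?_ hη
  · exact add_nonneg (div_nonneg (integral_nonneg fun φ => Nat.cast_nonneg _) (by positivity))
      (div_nonneg (integral_nonneg fun φ => tileError_nonneg _ _ _ _) (by positivity))
  · intro l n hl
    have h : ∀ φ : CountingMeasure d, (G (cech (points φ ∩ window d l) r) : ℝ) ≤
        ∑ z ∈ box (0 : Fin d → ℤ) n, (f (translate (-((m : ℝ) • latticePoint z)) φ) +
          tileError m ρ k (translate (-((m : ℝ) • latticePoint z)) φ)) := by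
      intro φ
      have := hG.window_le_sum_box hρ hm {()} hw0 hw1 hzero φ hl
      simpa only [Finset.sum_singleton, one_mul, neg_zero, translate_zero] using this
    calc ∫ φ, (G (cech (points φ ∩ window d l) r) : ℝ) ∂μ
        ≤ ∫ φ, ∑ z ∈ box (0 : Fin d → ℤ) n, (f (translate (-((m : ℝ) • latticePoint z)) φ) +
          tileError m ρ k (translate (-((m : ℝ) • latticePoint z)) φ)) ∂μ :=
          integral_mono (hG.integrable_cech_window hmom r l)
            (integrable_finsetSum _ fun z _ => (hcomp hf _).add (hcomp he _)) h
      _ = ((2 * n + 1) * m) ^ d * ((∫ φ, f φ ∂μ) / (m : ℝ) ^ d +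
          (∫ φ, tileError m ρ k φ ∂μ) / (m : ℝ) ^ d) := by
          refine (integral_sum_translate hT (hf.add he) (box (0 : Fin d → ℤ) n)
            fun z => -((m : ℝ) • latticePoint z)).trans ?_
          rw [integral_add' hf he, card_box, mul_pow]
          push_cast
          field_simp
  · intro l n hl
    have h : ∀ φ : CountingMeasure d,
        ∑ z ∈ box (0 : Fin d → ℤ) n, f (translate (-((m : ℝ) • latticePoint z)) φ) ≤
        (G (cech (points φ ∩ window d l) r) : ℝ) := by
      intro φ
      have := hG.sum_box_le_window r hm {()} hw0 hw1 hzero φ hl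
      simpa only [Finset.sum_singleton, one_mul, neg_zero, translate_zero] using this
    calc ((2 * n + 1) * m) ^ d * ((∫ φ, f φ ∂μ) / (m : ℝ) ^ d)
        = ∫ φ, ∑ z ∈ box (0 : Fin d → ℤ) n, f (translate (-((m : ℝ) • latticePoint z)) φ) ∂μ := by
          rw [integral_sum_translate hT hf (box (0 : Fin d → ℤ) n)
            fun z => -((m : ℝ) • latticePoint z), card_box, mul_pow]
          push_cast
          field_simp
      _ ≤ ∫ φ, (G (cech (points φ ∩ window d l) r) : ℝ) ∂μ :=
          integral_mono (integrable_finsetSum _ fun z _ => hcomp hf _)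
            (hG.integrable_cech_window hmom r l) h

end StationaryErgodic

/-! ### Almost sure convergence -/

section AlmostSure

open scoped ENNReal

variable {d : ℕ} {μ : Measure (CountingMeasure d)} [IsProbabilityMeasure μ]
  {G : PreAbstractSimplicialComplex (EuclideanSpace ℝ (Fin d)) → ℕ} {k : ℕ}

/-- Let `g` and `h` be the tile value and the tile error averaged over the chosen shifts, and `v =
|g - E| + h`. Where all box averages of `v` along the lattice stay below `δ * m ^ d`, the averaged
tilings squeeze the window between sums of `E - v` and `E + v`. The maximal inequality controls the
remaining set through `∫ v`. -/
theorem IsAlmostAdditive.measure_not_eventually_mem_Icc_le (hG : IsAlmostAdditive G k)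
    (hT : ∀ a, MeasurePreserving (translate a) μ μ)
    (herg : ∀ Θ, MeasurableSet Θ → (∀ a, μ (symmDiff (translate (-a) ⁻¹' Θ) Θ) = 0) →
      μ Θ = 0 ∨ μ Θ = 1)
    (hmom : ∀ a s n, Integrable (fun φ : CountingMeasure d => (φ.1 (cell a s)).toReal ^ n) μ)
    {r : ℝ} {ρ : ℕ} (hρ : 2 * r ≤ ρ) {m : ℕ} (hm : 0 < m) {δ η : ℝ} (hδ : 0 < δ) (hη : 0 < η) :
    ENNReal.ofReal δ * μ {φ | ¬ ∀ᶠ l : ℝ in atTop, (G (cech (points φ ∩ window d l) r) : ℝ) / l ^ d ∈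
      Set.Icc ((∫ φ, (G (cech (points φ ∩ cell 0 m) r) : ℝ) ∂μ) / (m : ℝ) ^ d - 2 * δ)
        ((∫ φ, (G (cech (points φ ∩ cell 0 m) r) : ℝ) ∂μ) / (m : ℝ) ^ d + 2 * δ)} ≤
      4 ^ d * ENNReal.ofReal (η + (∫ φ, tileError m ρ k φ ∂μ) / (m : ℝ) ^ d) := by
  have hm' : (0 : ℝ) < m := by exact_mod_cast hm
  have hmd : (0 : ℝ) < (m : ℝ) ^ d := by positivity
  set f : CountingMeasure d → ℝ := fun φ => (G (cech (points φ ∩ cell 0 m) r) : ℝ)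
  have hf2 : MemLp f 2 μ := hG.memLp_cech hmom 0 m r
  have hfm : Measurable f := hG.measurable_cech (measurableSet_cell _ _) (isBounded_cell _ _) r
  have hf : Integrable f μ := hf2.integrable (by norm_num)
  have he : Integrable (tileError m ρ k : CountingMeasure d → ℝ) μ := integrable_tileError hmom _ _ _
  have hem := measurable_tileError (d := d) m ρ k
  set E : ℝ := ∫ φ, f φ ∂μ
  have hE : 0 ≤ E := integral_nonneg fun φ => Nat.cast_nonneg _
  obtain ⟨ι, t, w, a, hw0, hw1, hclose⟩ := exists_convexCombination_close
    (T := fun a : EuclideanSpace ℝ (Fin d) => (translate (-a) : CountingMeasure d → CountingMeasure d))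
    (fun a => hT (-a)) (fun a b => ⟨a + b, funext fun φ => (translate_neg_add a b φ).symm⟩) herg hf2
    -- The tolerance `η * m ^ d` becomes `η` after division by the tile volume.
    (mul_pos hη hmd)
  have hR : ∀ i ∈ t, ∀ j, |a i j| ≤ ∑ i ∈ t, ‖a i‖ := by
    intro i hi j
    exact (PiLp.norm_apply_le (a i) j).trans
      (Finset.single_le_sum (f := fun i => ‖a i‖) (fun _ _ => norm_nonneg _) hi)
  let S : (Fin d → ℤ) → CountingMeasure d → CountingMeasure d :=
    fun z => translate (-((m : ℝ) • latticePoint z))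
  let g : CountingMeasure d → ℝ := fun φ => ∑ i ∈ t, w i * f (translate (-(a i)) φ)
  let h : CountingMeasure d → ℝ := fun φ => ∑ i ∈ t, w i * tileError m ρ k (translate (-(a i)) φ)
  have hgm : Measurable g := Finset.measurable_fun_sum _ fun i _ =>
    (hfm.comp (measurable_translate _)).const_mul _
  have hhm : Measurable h := Finset.measurable_fun_sum _ fun i _ =>
    (hem.comp (measurable_translate _)).const_mul _
  have hh0 : ∀ φ, 0 ≤ h φ := fun φ =>
    Finset.sum_nonneg fun i hi => mul_nonneg (hw0 i hi) (tileError_nonneg _ _ _ _)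
  have hgi : Integrable g μ := integrable_finsetSum _ fun i _ =>
    ((hT _).integrable_comp_of_integrable hf).const_mul _
  have hhi : Integrable h μ := integrable_finsetSum _ fun i _ =>
    ((hT _).integrable_comp_of_integrable he).const_mul _
  have hhE : ∫ φ, h φ ∂μ = ∫ φ, tileError m ρ k φ ∂μ := by
    simp only [h]
    have hi : ∀ i, Integrable (fun φ => w i * tileError m ρ k (translate (-(a i)) φ)) μ := fun i =>
      ((hT (-(a i))).integrable_comp_of_integrable he).const_mul _
    rw [integral_finsetSum _ fun i _ => hi i]
    simp only [integral_const_mul]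
    rw [Finset.sum_congr rfl fun i _ => congrArg _
      (integral_comp_of_measurePreserving (hT (-(a i))) he.aestronglyMeasurable),
      ← Finset.sum_mul, hw1, one_mul]
  let v : CountingMeasure d → ℝ := fun φ => |g φ - E| + h φ
  have hv0 : ∀ φ, 0 ≤ v φ := fun φ => add_nonneg (abs_nonneg _) (hh0 φ)
  have hvm : Measurable v := (hgm.sub_const E).abs.add hhm
  have hgE : Integrable (fun φ => |g φ - E|) μ := (hgi.sub (integrable_const E)).abs
  have hvi : Integrable v μ := hgE.add hhi
  have hvE : ∫ φ, v φ ∂μ ≤ η * (m : ℝ) ^ d + ∫ φ, tileError m ρ k φ ∂μ := by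
    simp only [v]
    rw [integral_add hgE hhi, hhE]
    gcongr
  have hmax := measure_maximal_le (μ := μ) (S := S) (fun z => hT _) (fun y z φ => by
    simp only [S, latticePoint_add, smul_add, translate_neg_add]) hvm.ennreal_ofReal
    (ENNReal.ofReal (δ * (m : ℝ) ^ d))
  rw [← ofReal_integral_eq_lintegral_ofReal hvi (Eventually.of_forall hv0)] at hmax
  have hsub : {φ : CountingMeasure d | ¬ ∀ᶠ l : ℝ in atTop,
      (G (cech (points φ ∩ window d l) r) : ℝ) / l ^ d ∈
      Set.Icc (E / (m : ℝ) ^ d - 2 * δ) (E / (m : ℝ) ^ d + 2 * δ)} ⊆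
      {φ | ∃ n : ℕ, ENNReal.ofReal (δ * (m : ℝ) ^ d) * ((2 * n + 1 : ℕ) : ℝ≥0∞) ^ d ≤
        ∑ y ∈ box 0 n, ENNReal.ofReal (v (S y φ))} := by
    intro φ hφ
    by_contra hno
    refine hφ ?_
    have hlt : ∀ n : ℕ, ∑ y ∈ box (0 : Fin d → ℤ) n, v (S y φ) ≤
        δ * (m : ℝ) ^ d * (2 * n + 1) ^ d := by
      intro n
      have h1 := not_le.1 (not_exists.1 hno n)
      rw [← ENNReal.ofReal_sum_of_nonneg fun y _ => hv0 _, ← ENNReal.ofReal_natCast,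
        ← ENNReal.ofReal_pow (Nat.cast_nonneg _), ← ENNReal.ofReal_mul (by positivity)] at h1
      have h2 := (ENNReal.ofReal_lt_ofReal_iff_of_nonneg
        (Finset.sum_nonneg fun y _ => hv0 _)).1 h1
      push_cast at h2
      exact h2.le
    -- One `δ` comes from the box averages of `v`, the other from passing to real `l`; together they
    -- give `2 * δ`.
    have key := eventually_div_pow_mem_Icc (d := d)
      (V := fun l => (G (cech (points φ ∩ window d l) r) : ℝ)) (m := m) (R := ∑ i ∈ t, ‖a i‖)
      (α := E / (m : ℝ) ^ d - δ) (β := E / (m : ℝ) ^ d + δ) (fun l => Nat.cast_nonneg _) hm'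
      (Finset.sum_nonneg fun _ _ => norm_nonneg _) (by positivity) ?_ ?_ hδ
    · filter_upwards [key] with l hl
      exact ⟨by linarith [hl.1], by linarith [hl.2]⟩
    · intro l n hl
      calc (G (cech (points φ ∩ window d l) r) : ℝ)
          ≤ ∑ z ∈ box (0 : Fin d → ℤ) n, (g (S z φ) + h (S z φ)) :=
            hG.window_le_sum_box hρ hm t hw0 hw1 hR φ hl
        _ ≤ ∑ z ∈ box (0 : Fin d → ℤ) n, (E + v (S z φ)) := by
            refine Finset.sum_le_sum fun z _ => ?_
            have := le_abs_self (g (S z φ) - E)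
            simp only [v]
            linarith
        _ ≤ ((2 * n + 1) * m) ^ d * (E / (m : ℝ) ^ d + δ) := by
            rw [Finset.sum_add_distrib, Finset.sum_const, card_box, nsmul_eq_mul, mul_pow, mul_add]
            push_cast
            have e1 : (2 * (n : ℝ) + 1) ^ d * (m : ℝ) ^ d * (E / (m : ℝ) ^ d) =
              (2 * (n : ℝ) + 1) ^ d * E := by field_simp
            rw [e1]
            linarith [hlt n]
    · intro l n hl
      calc ((2 * n + 1) * m) ^ d * (E / (m : ℝ) ^ d - δ)
          ≤ ∑ z ∈ box (0 : Fin d → ℤ) n, (E - v (S z φ)) := by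
            rw [Finset.sum_sub_distrib, Finset.sum_const, card_box, nsmul_eq_mul, mul_pow, mul_sub]
            push_cast
            have e1 : (2 * (n : ℝ) + 1) ^ d * (m : ℝ) ^ d * (E / (m : ℝ) ^ d) =
              (2 * (n : ℝ) + 1) ^ d * E := by field_simp
            rw [e1]
            linarith [hlt n]
        _ ≤ ∑ z ∈ box (0 : Fin d → ℤ) n, g (S z φ) := by
            refine Finset.sum_le_sum fun z _ => ?_
            have h1 := neg_abs_le (g (S z φ) - E)
            have h2 := hh0 (S z φ)
            simp only [v]
            linarith
        _ ≤ (G (cech (points φ ∩ window d l) r) : ℝ) :=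
            hG.sum_box_le_window r hm t hw0 hw1 hR φ hl
  have h0 : ENNReal.ofReal ((m : ℝ) ^ d) ≠ 0 := (ENNReal.ofReal_pos.2 hmd).ne'
  rw [← ENNReal.mul_le_mul_iff_right h0 ENNReal.ofReal_ne_top]
  calc ENNReal.ofReal ((m : ℝ) ^ d) * (ENNReal.ofReal δ * μ _)
      = ENNReal.ofReal (δ * (m : ℝ) ^ d) * μ _ := by
        rw [ENNReal.ofReal_mul hδ.le]
        ring
    _ ≤ ENNReal.ofReal (δ * (m : ℝ) ^ d) * μ _ := by gcongr
    _ ≤ 4 ^ d * ENNReal.ofReal (∫ φ, v φ ∂μ) := hmax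
    _ ≤ 4 ^ d * ENNReal.ofReal ((m : ℝ) ^ d * (η + (∫ φ, tileError m ρ k φ ∂μ) / (m : ℝ) ^ d)) := by
        gcongr
        refine hvE.trans_eq ?_
        field_simp
    _ = ENNReal.ofReal ((m : ℝ) ^ d) *
        (4 ^ d * ENNReal.ofReal (η + (∫ φ, tileError m ρ k φ ∂μ) / (m : ℝ) ^ d)) := by
        rw [ENNReal.ofReal_mul hmd.le]
        ring

/-- The law of large numbers for an almost additive functional of the Čech complexes of a
stationary ergodic process. -/
theorem IsAlmostAdditive.exists_limit (hG : IsAlmostAdditive G k)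
    (hT : ∀ a, MeasurePreserving (translate a) μ μ)
    (herg : ∀ Θ, MeasurableSet Θ → (∀ a, μ (symmDiff (translate (-a) ⁻¹' Θ) Θ) = 0) →
      μ Θ = 0 ∨ μ Θ = 1)
    (hmom : ∀ a s n, Integrable (fun φ : CountingMeasure d => (φ.1 (cell a s)).toReal ^ n) μ)
    (r : ℝ) :
    ∃ e : ℝ, Tendsto (fun l : ℝ =>
        (∫ φ, (G (cech (points φ ∩ window d l) r) : ℝ) ∂μ) / l ^ d) atTop (𝓝 e) ∧
      ∀ᵐ φ ∂μ, Tendsto (fun l : ℝ => (G (cech (points φ ∩ window d l) r) : ℝ) / l ^ d) atTop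
        (𝓝 e) := by
  obtain ⟨ρ, hρ⟩ := exists_nat_ge (2 * r)
  -- The index is shifted so that the tile side `m + 1` is positive.
  let κ : ℕ → ℝ := fun m =>
    (∫ φ, tileError (m + 1) ρ k φ ∂μ) / ((m + 1 : ℕ) : ℝ) ^ d
  have hκ : Tendsto κ atTop (𝓝 0) :=
    (tendsto_add_atTop_iff_nat (f := fun m : ℕ =>
      (∫ φ, tileError m ρ k φ ∂μ) / (m : ℝ) ^ d) 1).2 (tendsto_integral_tileError_div hT hmom ρ k)
  obtain ⟨e, he, hlim⟩ := exists_limit_of_eventually_mem_Icc (κ := κ)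
    (a := fun m : ℕ => (∫ φ, (G (cech (points φ ∩ cell 0 ((m + 1 : ℕ) : ℝ)) r) : ℝ) ∂μ) /
      ((m + 1 : ℕ) : ℝ) ^ d) hκ
    (fun m η hη => hG.eventually_mean_mem_Icc hT hmom hρ (Nat.succ_pos m) hη)
  refine ⟨e, hlim, ?_⟩
  have hδ : ∀ δ : ℝ, 0 < δ → ∀ᵐ φ ∂μ, ∀ᶠ l : ℝ in atTop,
      |(G (cech (points φ ∩ window d l) r) : ℝ) / l ^ d - e| ≤ 3 * δ := by
    intro δ hδ
    set bad : Set (CountingMeasure d) := {φ | ¬ ∀ᶠ l : ℝ in atTop,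
      |(G (cech (points φ ∩ window d l) r) : ℝ) / l ^ d - e| ≤ 3 * δ}
    change μ bad = 0
    -- The set `bad` does not depend on `m`: the tile mean lies within `κ m < δ` of `e`, so `2 * δ`
    -- about it becomes `3 * δ` about `e`. The bound tends to `0`, hence `bad` is null.
    have hbound : ∀ᶠ m : ℕ in atTop, ENNReal.ofReal δ * μ bad ≤
        4 ^ d * ENNReal.ofReal (1 / ((m : ℝ) + 1) + κ m) := by
      filter_upwards [hκ.eventually_lt_const hδ] with m hm
      refine le_trans ?_ (hG.measure_not_eventually_mem_Icc_le hT herg hmom hρ (Nat.succ_pos m) hδ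
        (η := 1 / ((m : ℝ) + 1)) (by positivity))
      gcongr
      intro φ hφ hev
      refine hφ ?_
      filter_upwards [hev] with l hl
      have h1 := he m
      rw [abs_le]
      constructor
      · linarith [hl.1, h1.2]
      · linarith [hl.2, h1.1]
    have hz : Tendsto (fun m : ℕ => 4 ^ d * ENNReal.ofReal (1 / ((m : ℝ) + 1) + κ m)) atTop
        (𝓝 (4 ^ d * ENNReal.ofReal (0 + 0))) :=
      ENNReal.Tendsto.const_mul (ENNReal.tendsto_ofReal
        (tendsto_one_div_add_atTop_nhds_zero_nat.add hκ)) (Or.inr (by simp))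
    have h0 := ge_of_tendsto hz hbound
    simp only [add_zero, ENNReal.ofReal_zero, mul_zero, nonpos_iff_eq_zero, mul_eq_zero] at h0
    exact h0.resolve_left (ENNReal.ofReal_pos.2 hδ).ne'
  have hall : ∀ᵐ φ ∂μ, ∀ j : ℕ, ∀ᶠ l : ℝ in atTop,
      |(G (cech (points φ ∩ window d l) r) : ℝ) / l ^ d - e| ≤ 3 * (1 / ((j : ℝ) + 1)) :=
    ae_all_iff.2 fun j => hδ _ (by positivity)
  filter_upwards [hall] with φ hφ
  rw [Metric.tendsto_nhds]
  intro ε hε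
  obtain ⟨j, hj⟩ := exists_nat_one_div_lt (show 0 < ε / 3 by positivity)
  filter_upwards [hφ j] with l hl
  rw [Real.dist_eq]
  linarith

end AlmostSure

/-! ### Transfer of the hypotheses to the law of the process -/

section Law

variable {d : ℕ} {Ω : Type*} [MeasurableSpace Ω] {P : Measure Ω} {Φ : Ω → CountingMeasure d}

theorem measurePreserving_translate_law (hΦ : Measurable Φ) (h_stat : IsStationaryProcess P Φ)
    (a : EuclideanSpace ℝ (Fin d)) :
    MeasurePreserving (translate a) (P.map Φ) (P.map Φ) := by
  refine ⟨measurable_translate a, ?_⟩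
  rw [Measure.map_map (measurable_translate a) hΦ]
  exact h_stat a

theorem image_translate (a : EuclideanSpace ℝ (Fin d)) (Θ : Set (CountingMeasure d)) :
    translate a '' Θ = translate (-a) ⁻¹' Θ := by
  ext φ
  constructor
  · rintro ⟨ψ, hψ, rfl⟩
    change translate (-a) (translate a ψ) ∈ Θ
    rwa [← translate_add, neg_add_cancel, translate_zero]
  · intro hφ
    refine ⟨translate (-a) φ, hφ, ?_⟩
    rw [← translate_add, add_neg_cancel, translate_zero]

theorem ergodic_law (hΦ : Measurable Φ) (h_erg : IsErgodicProcess P Φ)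
    (Θ : Set (CountingMeasure d)) (hΘ : MeasurableSet Θ)
    (h : ∀ a, P.map Φ (symmDiff (translate (-a) ⁻¹' Θ) Θ) = 0) :
    P.map Φ Θ = 0 ∨ P.map Φ Θ = 1 := by
  rw [Measure.map_apply hΦ hΘ]
  refine h_erg Θ hΘ fun a => ?_
  have := h a
  rw [Measure.map_apply hΦ ((measurable_translate (-a) hΘ).symmDiff hΘ), symmDiff_comm] at this
  rw [image_translate]
  exact this

theorem integrable_pow_measure_cell (hΦ : Measurable Φ) [IsProbabilityMeasure P]
    (h_mom : HasAllMoments P Φ) (a : EuclideanSpace ℝ (Fin d)) (s : ℝ) (n : ℕ) :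
    Integrable (fun φ : CountingMeasure d => (φ.1 (cell a s)).toReal ^ n) (P.map Φ) := by
  have hm := measurable_apply (measurableSet_cell a s)
  have : IsProbabilityMeasure (P.map Φ) := Measure.isProbabilityMeasure_map hΦ.aemeasurable
  rcases Nat.eq_zero_or_pos n with rfl | hn
  · simp
  simp only [← ENNReal.toReal_pow]
  refine integrable_toReal_of_lintegral_ne_top (hm.pow_const n).aemeasurable ?_
  rw [lintegral_map (hm.pow_const n) hΦ]
  exact (h_mom _ (measurableSet_cell a s) (isBounded_cell a s) n hn).ne

end Law

end CechBetti

end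

/-! ### The limit theorem for Betti numbers -/

theorem mainTheorem2 (F : Type*) [Field F] {d : ℕ} {Ω : Type*} [MeasurableSpace Ω]
    (P : Measure Ω) [IsProbabilityMeasure P] (Φ : Ω → CountingMeasure d) (hΦ : Measurable Φ)
    (h_simple : IsSimpleProcess P Φ) (h_stat : IsStationaryProcess P Φ) (h_erg : IsErgodicProcess P Φ)
    (h_int : HasUnitIntensity P Φ) (h_mom : HasAllMoments P Φ)
    (r : ℝ) (hr : 0 < r) (k : ℕ) (hk : k < d) :
    ∃ e : ℝ, 0 ≤ e ∧
      (∀ l : ℝ, Integrable (bettiInWindow Φ F k r l) P) ∧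
      Tendsto (fun l : ℝ => (∫ ω, bettiInWindow Φ F k r l ω ∂P) / l ^ d) atTop (𝓝 e) ∧
      ∀ᵐ ω ∂P, Tendsto (fun l : ℝ => bettiInWindow Φ F k r l ω / l ^ d) atTop (𝓝 e) := by
  have : IsProbabilityMeasure (P.map Φ) := Measure.isProbabilityMeasure_map hΦ.aemeasurable
  have hT := measurePreserving_translate_law hΦ h_stat
  have herg := ergodic_law hΦ h_erg
  have hmom := integrable_pow_measure_cell hΦ h_mom
  -- `β` is the difference of these two functionals; each has a limit, and the limits subtract.
  have hG₁ := isAlmostAdditive_betti_add_simplexCount (V := EuclideanSpace ℝ (Fin d)) F k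
  have hG₂ := isAlmostAdditive_simplexCount (V := EuclideanSpace ℝ (Fin d)) F k
  obtain ⟨e₁, hmean₁, has₁⟩ := hG₁.exists_limit hT herg hmom r
  obtain ⟨e₂, hmean₂, has₂⟩ := hG₂.exists_limit hT herg hmom r
  have hi₁ := hG₁.integrable_cech_window hmom r
  have hi₂ := hG₂.integrable_cech_window hmom r
  let b : ℝ → CountingMeasure d → ℝ := fun l φ => betti F (cech (points φ ∩ window d l) r) k
  have hb : ∀ l, b l = fun φ =>
      ((betti F (cech (points φ ∩ window d l) r) k +
        simplexCount F k (cech (points φ ∩ window d l) r) : ℕ) : ℝ) -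
      (simplexCount F k (cech (points φ ∩ window d l) r) : ℝ) := by
    intro l
    funext φ
    simp [b]
  have hbi : ∀ l, Integrable (b l) (P.map Φ) := by
    intro l
    rw [hb]
    exact (hi₁ l).sub (hi₂ l)
  have hmean : Tendsto (fun l : ℝ => (∫ ω, bettiInWindow Φ F k r l ω ∂P) / l ^ d) atTop
      (𝓝 (e₁ - e₂)) := by
    refine (hmean₁.sub hmean₂).congr fun l => ?_
    have h : ∫ ω, bettiInWindow Φ F k r l ω ∂P = ∫ φ, b l φ ∂(P.map Φ) :=
      (integral_map hΦ.aemeasurable (hbi l).aestronglyMeasurable).symm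
    rw [h, hb, integral_sub (hi₁ l) (hi₂ l), sub_div]
  refine ⟨e₁ - e₂, ?_, fun l => (hbi l).comp_measurable hΦ, hmean, ?_⟩
  · refine ge_of_tendsto hmean ?_
    filter_upwards [eventually_ge_atTop 0] with l hl
    exact div_nonneg (integral_nonneg fun ω => Nat.cast_nonneg _) (pow_nonneg hl d)
  · filter_upwards [ae_of_ae_map hΦ.aemeasurable has₁, ae_of_ae_map hΦ.aemeasurable has₂]
      with ω h₁ h₂
    refine (h₁.sub h₂).congr fun l => ?_
    change _ = b l (Φ ω) / l ^ d
    rw [hb, sub_div]
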